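/- **Setting.** The language of second-order arithmetic is two-sorted first-order logic with equality on the number sort: number terms are built from number variables by $0,S,+,\cdot$, and atomic formulae are $s=t$, $s<t$ and $t\in X$ ($X$ a set variable). A formula is bounded if it has no set quantifiers and all its number quantifiers are bounded; a $\Sigma^0_1$ formula is a block of existential number quantifiers followed by a bounded formula (free set variables are allowed). $\mathsf{RCA}_0$ consists of Robinson arithmetic $\mathsf{Q}$ (with $x<y\leftrightarrow\exists z\,(x+Sz=y)$), the universal closures of the induction axioms for $\Sigma^0_1$ formulae, and the universal closures of the recursive comprehension axioms $$\forall x\,(\varphi(x)\leftrightarrow\neg\psi(x))\rightarrow\exists X\,\forall x\,(x\in X\leftrightarrow\varphi(x)),\qquad \varphi,\psi\in\Sigma^0_1,\ X \text{ not free in } \varphi,\psi .$$ $T\vdash\varphi$ means that $\varphi$ is a logical consequence of $T$, i.e. true in every two-sorted structure satisfying $T$ (the set quantifiers range over an arbitrary second domain). A nondeterministic Büchi automaton (NBA) is $\mathcal A=(A,Q,\delta,q_0,F)$ with a finite alphabet $A$, a finite set of states $Q$, $\delta\subseteq(Q\times A)\times Q$, $q_0\in Q$ and $F\subseteq Q$.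 Letters and states are coded injectively by natural numbers and named in formulae by numerals, and $X(s,t)$ abbreviates $(s+t)^2+s\in X$. For a finite set $S$, $X\in S^\omega$ is the formula $\forall x\,\exists y\in S\,X(x,y)\wedge\forall x,y,z\,(X(x,y)\wedge X(x,z)\rightarrow y=z)$, and $X\in\mathcal L(\mathcal A)$ is the formula $$X\in A^\omega\wedge\exists Y\in Q^\omega\,\bigl(Y(0,q_0)\wedge\forall x\,(Y(x),X(x),Y(Sx))\in\delta\wedge\forall x\,\exists x'>x\; Y(x')\in F\bigr).$$ **The complement automaton.** For a finite word $\sigma\in A^*$ let $\delta(\sigma):Q\times Q\to\{0,1,\infty\}$ be the matrix whose entry at $(q,q')$ is $\infty$ if some path of $\mathcal A$ from $q$ to $q'$ following $\sigma$ hits a state of $F$ after its starting point, is $1$ if there is a path from $q$ to $q'$ following $\sigma$ but none of this kind, and is $0$ otherwise. Let $\delta(A^*)=\{\delta(\sigma):\sigma\in A^*\}$, and compose matrices by $(\beta\gamma)(q,q')=\max_{p\in Q}\beta(q,p)\cdot\gamma(p,q')$, where $0\cdot\infty=\infty\cdot0=0$. A pair $(\beta,\gamma)$ is rejecting if $\beta\gamma=\beta$,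 $\gamma\gamma=\gamma$, and $\gamma(q,q)<\infty$ for every $q\in Q$ with $\beta(q_0,q)>0$. The NBA $\mathcal A^c$ has alphabet $A$, set of states $\{q_0\}\sqcup\delta(A^*)\sqcup\delta(A^*)^2\sqcup\delta(A^*)^3$, initial state $q_0$, set of accepting states $\delta(A^*)$, and the following transitions, for all $a\in A$ and $\beta,\gamma,\zeta\in\delta(A^*)$: - $(q_0,a,(\beta,\gamma,\delta(a)))$ if $(\beta,\gamma)$ is rejecting; - $((\beta,\gamma,\zeta),a,(\beta,\gamma,\zeta\delta(a)))$; - $((\beta,\gamma,\zeta),a,\gamma)$ if $\zeta\delta(a)=\beta$; - $(\gamma,a,(\gamma,\delta(a)))$; - $((\gamma,\zeta),a,(\gamma,\zeta\delta(a)))$; - $((\gamma,\zeta),a,\gamma)$ if $\zeta\delta(a)=\gamma$; - $(\gamma,a,\gamma)$ if $\delta(a)=\gamma$. **Proposition.** For every NBA $\mathcal A$ (and every choice of injective codings of the letters of $A$, of the states of $\mathcal A$ and of the states of $\mathcal A^c$ by natural numbers), $$\mathsf{RCA}_0\vdash\forall X\in A^\omega\,\bigl(X\in\mathcal L(\mathcal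 A^c)\leftrightarrow X\notin\mathcal L(\mathcal A)\bigr).$$ The quantification over automata is external to $\mathsf{RCA}_0$. -/

import Mathlib

universe u

/-! ### The two-sorted language of second-order arithmetic -/

namespace SOArith

/-- Number terms over `0, S, +, ·` with `n` number variables (de Bruijn indices). -/
inductive Tm (n : ℕ) : Type
  | var (i : Fin n) : Tm n
  | zero : Tm n
  | succ (t : Tm n) : Tm n
  | add (s t : Tm n) : Tm n
  | mul (s t : Tm n) : Tm n

/-- Formulae with `n` free number variables and `m` free set variables. Each quantifier binds
the variable with index `0` of its sort and shifts the others up by one. -/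
inductive Fm : ℕ → ℕ → Type
  | eq {n m : ℕ} (s t : Tm n) : Fm n m
  | lt {n m : ℕ} (s t : Tm n) : Fm n m
  | mem {n m : ℕ} (t : Tm n) (X : Fin m) : Fm n m
  | neg {n m : ℕ} (φ : Fm n m) : Fm n m
  | and {n m : ℕ} (φ ψ : Fm n m) : Fm n m
  | or {n m : ℕ} (φ ψ : Fm n m) : Fm n m
  | allN {n m : ℕ} (φ : Fm (n + 1) m) : Fm n m
  | exN {n m : ℕ} (φ : Fm (n + 1) m) : Fm n m
  | allS {n m : ℕ} (φ : Fm n (m + 1)) : Fm n m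
  | exS {n m : ℕ} (φ : Fm n (m + 1)) : Fm n m

/-- Simultaneous substitution of terms for number variables in a term. -/
def Tm.subst {n k : ℕ} (σ : Fin n → Tm k) : Tm n → Tm k
  | .var i => σ i
  | .zero => .zero
  | .succ t => .succ (t.subst σ)
  | .add s t => .add (s.subst σ) (t.subst σ)
  | .mul s t => .mul (s.subst σ) (t.subst σ)

/-- The term `t` in a context with one additional number variable (of index `0`). -/
def Tm.shift {n : ℕ} (t : Tm n) : Tm (n + 1) :=
  t.subst (fun i => .var i.succ)

/-- The numeral `S ⋯ S 0`. -/
def Tm.num {n : ℕ} : ℕ → Tm n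
  | 0 => .zero
  | k + 1 => .succ (Tm.num k)

namespace Fm

/-- Simultaneous (capture-avoiding) substitution of terms for number variables and renaming of
set variables. -/
def subst : {n m k l : ℕ} → (Fin n → Tm k) → (Fin m → Fin l) → Fm n m → Fm k l
  | _, _, _, _, σ, _, eq s t => eq (s.subst σ) (t.subst σ)
  | _, _, _, _, σ, _, lt s t => lt (s.subst σ) (t.subst σ)
  | _, _, _, _, σ, τ, mem t X => mem (t.subst σ) (τ X)
  | _, _, _, _, σ, τ, neg φ => neg (subst σ τ φ)
  | _, _, _, _, σ, τ, and φ ψ => and (subst σ τ φ) (subst σ τ ψ)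
  | _, _, _, _, σ, τ, or φ ψ => or (subst σ τ φ) (subst σ τ ψ)
  | _, _, _, _, σ, τ, allN φ => allN (subst (Fin.cons (.var 0) (fun i => (σ i).shift)) τ φ)
  | _, _, _, _, σ, τ, exN φ => exN (subst (Fin.cons (.var 0) (fun i => (σ i).shift)) τ φ)
  | _, _, _, _, σ, τ, allS φ => allS (subst σ (Fin.cons 0 (fun i => (τ i).succ)) φ)
  | _, _, _, _, σ, τ, exS φ => exS (subst σ (Fin.cons 0 (fun i => (τ i).succ)) φ)

/-- `φ ⊃ ψ`. -/
def imp {n m : ℕ} (φ ψ : Fm n m) : Fm n m := or (neg φ) ψ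

/-- `φ ≡ ψ`. -/
def iff {n m : ℕ} (φ ψ : Fm n m) : Fm n m := and (imp φ ψ) (imp ψ φ)

/-- Disjunction of a finite list of formulae; the empty disjunction is `¬ 0 = 0`. -/
def disj {n m : ℕ} : List (Fm n m) → Fm n m
  | [] => neg (eq .zero .zero)
  | φ :: l => or φ (disj l)

/-- Universal closure with respect to the number variables. -/
def closeN : {n m : ℕ} → Fm n m → Fm 0 m
  | 0, _, φ => φ
  | _ + 1, _, φ => closeN (allN φ)

/-- Universal closure with respect to the set variables. -/
def closeS : {m : ℕ} → Fm 0 m → Fm 0 0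
  | 0, φ => φ
  | _ + 1, φ => closeS (allS φ)

/-- Universal closure. -/
def close {n m : ℕ} (φ : Fm n m) : Fm 0 0 := closeS (closeN φ)

/-- Bounded formulae: no set quantifiers, and all number quantifiers are of the form
`∀ x < t` or `∃ x < t`, where the term `t` does not contain `x`. Free set variables may occur. -/
inductive Bounded : {n m : ℕ} → Fm n m → Prop
  | eq {n m : ℕ} (s t : Tm n) : Bounded (Fm.eq s t : Fm n m)
  | lt {n m : ℕ} (s t : Tm n) : Bounded (Fm.lt s t : Fm n m)
  | mem {n m : ℕ} (t : Tm n) (X : Fin m) : Bounded (Fm.mem t X)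
  | neg {n m : ℕ} {φ : Fm n m} : Bounded φ → Bounded (Fm.neg φ)
  | and {n m : ℕ} {φ ψ : Fm n m} : Bounded φ → Bounded ψ → Bounded (Fm.and φ ψ)
  | or {n m : ℕ} {φ ψ : Fm n m} : Bounded φ → Bounded ψ → Bounded (Fm.or φ ψ)
  | ballN {n m : ℕ} (t : Tm n) {φ : Fm (n + 1) m} : Bounded φ →
      Bounded (Fm.allN (Fm.imp (Fm.lt (.var 0) t.shift) φ))
  | bexN {n m : ℕ} (t : Tm n) {φ : Fm (n + 1) m} : Bounded φ →
      Bounded (Fm.exN (Fm.and (Fm.lt (.var 0) t.shift) φ))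

/-- `Σ⁰₁` formulae: a block of existential number quantifiers in front of a bounded formula. -/
inductive Sigma1 : {n m : ℕ} → Fm n m → Prop
  | bounded {n m : ℕ} {φ : Fm n m} : Bounded φ → Sigma1 φ
  | exN {n m : ℕ} {φ : Fm (n + 1) m} : Sigma1 φ → Sigma1 (Fm.exN φ)

end Fm

/-! ### Semantics: logical consequence -/

/-- A structure for the two-sorted language. Equality of numbers is interpreted as
true equality, the set quantifiers range over an arbitrary second domain. -/
structure Str : Type (u + 1) where
  Num : Type u
  Sets : Type u
  zero : Num
  succ : Num → Num
  add : Num → Num → Num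
  mul : Num → Num → Num
  lt : Num → Num → Prop
  mem : Num → Sets → Prop

/-- The value of a term. -/
def Tm.eval (M : Str.{u}) {n : ℕ} (ρ : Fin n → M.Num) : Tm n → M.Num
  | .var i => ρ i
  | .zero => M.zero
  | .succ t => M.succ (t.eval M ρ)
  | .add s t => M.add (s.eval M ρ) (t.eval M ρ)
  | .mul s t => M.mul (s.eval M ρ) (t.eval M ρ)

/-- Truth of a formula in a structure under an assignment. -/
def Fm.Realize (M : Str.{u}) :
    {n m : ℕ} → Fm n m → (Fin n → M.Num) → (Fin m → M.Sets) → Prop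
  | _, _, .eq s t, ρ, _ => s.eval M ρ = t.eval M ρ
  | _, _, .lt s t, ρ, _ => M.lt (s.eval M ρ) (t.eval M ρ)
  | _, _, .mem t X, ρ, η => M.mem (t.eval M ρ) (η X)
  | _, _, .neg φ, ρ, η => ¬ Fm.Realize M φ ρ η
  | _, _, .and φ ψ, ρ, η => Fm.Realize M φ ρ η ∧ Fm.Realize M ψ ρ η
  | _, _, .or φ ψ, ρ, η => Fm.Realize M φ ρ η ∨ Fm.Realize M ψ ρ η
  | _, _, .allN φ, ρ, η => ∀ a : M.Num, Fm.Realize M φ (Fin.cons a ρ) η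
  | _, _, .exN φ, ρ, η => ∃ a : M.Num, Fm.Realize M φ (Fin.cons a ρ) η
  | _, _, .allS φ, ρ, η => ∀ A : M.Sets, Fm.Realize M φ ρ (Fin.cons A η)
  | _, _, .exS φ, ρ, η => ∃ A : M.Sets, Fm.Realize M φ ρ (Fin.cons A η)

/-- Truth of a closed formula in a structure. -/
def Str.Sat (M : Str.{u}) (φ : Fm 0 0) : Prop :=
  φ.Realize M Fin.elim0 Fin.elim0

/-- `T ⊢ φ`: the closed formula `φ` is a logical consequence of the theory `T`, that is, `φ` is
true in every structure in which all members of `T` are true. -/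
def Proves (T : Set (Fm 0 0)) (φ : Fm 0 0) : Prop :=
  ∀ M : Str.{u}, (∀ ψ ∈ T, M.Sat ψ) → M.Sat φ

/-! ### The theory `RCA₀` -/

open Tm Fm in
/-- The axioms of Robinson arithmetic with inequality. -/
inductive RobinsonAx : Fm 0 0 → Prop
  /-- `∀ x. S x ≠ 0` -/
  | q1 : RobinsonAx (allN (neg (eq (succ (var 0)) zero)))
  /-- `∀ x y. (S x = S y ⊃ x = y)` -/
  | q2 : RobinsonAx (allN (allN
      (imp (eq (succ (var 1)) (succ (var 0))) (eq (var 1) (var 0)))))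
  /-- `∀ x. (x ≠ 0 ⊃ ∃ y. x = S y)` -/
  | q3 : RobinsonAx (allN
      (imp (neg (eq (var 0) zero)) (exN (eq (var 1) (succ (var 0))))))
  /-- `∀ x. x + 0 = x` -/
  | q4 : RobinsonAx (allN (eq (add (var 0) zero) (var 0)))
  /-- `∀ x y. x + S y = S (x + y)` -/
  | q5 : RobinsonAx (allN (allN
      (eq (add (var 1) (succ (var 0))) (succ (add (var 1) (var 0))))))
  /-- `∀ x. x · 0 = 0` -/
  | q6 : RobinsonAx (allN (eq (mul (var 0) zero) zero))
  /-- `∀ x y. x · S y = x · y + x` -/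
  | q7 : RobinsonAx (allN (allN
      (eq (mul (var 1) (succ (var 0))) (add (mul (var 1) (var 0)) (var 1)))))
  /-- `∀ x y. (x < y ≡ ∃ z. x + S z = y)` -/
  | q8 : RobinsonAx (allN (allN
      (iff (lt (var 1) (var 0)) (exN (eq (add (var 2) (succ (var 0))) (var 1))))))

/-- The induction axiom `(φ(0) ∧ ∀ x. (φ(x) ⊃ φ(S x))) ⊃ ∀ x. φ(x)`, where `x` is the number
variable `0`; the other free variables of `φ` are parameters. -/
def inductionAx {n m : ℕ} (φ : Fm (n + 1) m) : Fm n m :=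
  .imp
    (.and (φ.subst (Fin.cons .zero .var) id)
      (.allN (.imp φ (φ.subst (Fin.cons (.succ (.var 0)) (fun i => .var i.succ)) id))))
    (.allN φ)

/-- The comprehension axiom `∀ x. (φ(x) ≡ ¬ ψ(x)) ⊃ ∃ X. ∀ x. (x ∈ X ≡ φ(x))`, where `x` is the
number variable `0`; the other free variables of `φ` and `ψ` are parameters. -/
def comprehensionAx {n m : ℕ} (φ ψ : Fm (n + 1) m) : Fm n m :=
  .imp (.allN (.iff φ (.neg ψ)))
    (.exS (.allN (.iff (.mem (.var 0) 0) (φ.subst .var Fin.succ))))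

/-- `RCA₀`: Robinson arithmetic, induction for `Σ⁰₁` formulae and comprehension for `Δ⁰₁`
formulae, the schemata being closed universally. -/
inductive RCA0Ax : Fm 0 0 → Prop
  | robinson {φ : Fm 0 0} : RobinsonAx φ → RCA0Ax φ
  | induction {n m : ℕ} (φ : Fm (n + 1) m) : φ.Sigma1 → RCA0Ax (inductionAx φ).close
  | comprehension {n m : ℕ} (φ ψ : Fm (n + 1) m) : φ.Sigma1 → ψ.Sigma1 →
      RCA0Ax (comprehensionAx φ ψ).close

/-- The set of axioms of `RCA₀`. -/
def RCA0 : Set (Fm 0 0) := {φ | RCA0Ax φ}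

/-! ### Sets as binary predicates, and sequences over a finite set -/

/-- The pairing `(s + t)² + s`. -/
def Tm.pair {n : ℕ} (s t : Tm n) : Tm n := .add (.mul (.add s t) (.add s t)) s

/-- `X(s, t)`: the set `X` is read as a binary predicate. -/
def Fm.app {n m : ℕ} (X : Fin m) (s t : Tm n) : Fm n m := .mem (s.pair t) X

/-- For a subset `S` of a finite set whose elements are coded by natural numbers, the formula
`t ∈ S`, i.e. the disjunction of all `t = s` with `s ∈ S`. -/
noncomputable def Fm.inFin {α : Type*} [Finite α] (c : α → ℕ) (S : Set α) {n m : ℕ} (t : Tm n) :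
    Fm n m :=
  .disj ((Set.toFinite S).toFinset.toList.map (fun s => .eq t (.num (c s))))

/-- `X ∈ S^ω`, where `S` is a finite set coded by `c`:
`∀ x. ∃ y ∈ S. X(x, y)` and `∀ x y z. ((X(x, y) ∧ X(x, z)) ⊃ y = z)`. -/
noncomputable def Fm.isSeq {α : Type*} [Finite α] (c : α → ℕ) {n m : ℕ} (X : Fin m) : Fm n m :=
  .and
    (.allN (.exN (.and (.inFin c Set.univ (.var 0)) (.app X (.var 1) (.var 0)))))
    (.allN (.allN (.allN
      (.imp (.and (.app X (.var 2) (.var 1)) (.app X (.var 2) (.var 0)))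
        (.eq (.var 1) (.var 0))))))

end SOArith

/-! ### Büchi automata -/

/-- A nondeterministic Büchi automaton with alphabet `A` and set of states `Q`
(both will be finite). -/
structure NBA (A Q : Type*) where
  /-- the transition relation -/
  δ : Set ((Q × A) × Q)
  /-- the initial state -/
  q₀ : Q
  /-- the accepting states -/
  F : Set Q

namespace NBA

section Language

open SOArith

variable {A Q : Type*} [Finite A] [Finite Q]

/-- `(p, a, q) ∈ δ` for terms `p, a, q`. -/
noncomputable def inδ (𝒜 : NBA A Q) (cA : A → ℕ) (cQ : Q → ℕ) {n m : ℕ} (p a q : Tm n) :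
    Fm n m :=
  .disj ((Set.toFinite 𝒜.δ).toFinset.toList.map (fun e =>
    .and (.eq p (.num (cQ e.1.1))) (.and (.eq a (.num (cA e.1.2))) (.eq q (.num (cQ e.2))))))

/-- The formula `X ∈ L(𝒜)` in the free set variable `X`, where letters and states are coded by
`cA` and `cQ`: `X ∈ A^ω`, and there is `Y ∈ Q^ω` such that `Y(0, q₀)`,
`∀ x. (Y(x), X(x), Y(S x)) ∈ δ` and `∀ x. ∃ x' > x. Y(x') ∈ F`. -/
noncomputable def inLang (𝒜 : NBA A Q) (cA : A → ℕ) (cQ : Q → ℕ) {n m : ℕ} (X : Fin m) :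
    Fm n m :=
  .and (.isSeq cA X)
    (.exS (.and (.isSeq cQ 0)
      (.and (.app 0 .zero (.num (cQ 𝒜.q₀)))
        (.and
          -- the bound number variables are `x, p, a, q`, in this order
          (.allN (.exN (.exN (.exN
            (.and (.app 0 (.var 3) (.var 2))
              (.and (.app X.succ (.var 3) (.var 1))
                (.and (.app 0 (.succ (.var 3)) (.var 0))
                  (𝒜.inδ cA cQ (.var 2) (.var 1) (.var 0)))))))))
          -- the bound number variables are `x, x', y`, in this order
          (.allN (.exN (.and (.lt (.var 1) (.var 0))
            (.exN (.and (.app 0 (.var 1) (.var 0)) (.inFin cQ 𝒜.F (.var 0)))))))))))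

end Language

section Complement

variable {A Q : Type*}

/-- `x` is a path through `δ` from `q` to `q'` following the word `σ`. -/
def IsPath (𝒜 : NBA A Q) (σ : List A) (q q' : Q) (x : Fin (σ.length + 1) → Q) : Prop :=
  x 0 = q ∧ x (Fin.last _) = q' ∧
    ∀ i : Fin σ.length, ((x i.castSucc, σ.get i), x i.succ) ∈ 𝒜.δ

open Classical in
/-- The transition matrix `δ(σ) : Q × Q → {0, 1, ∞}` of a word `σ`: the entry at `(q, q')` is `∞`
if some path from `q` to `q'` following `σ` hits an accepting state after `q`, otherwise it is `1`
if there is a path from `q` to `q'` following `σ`, and `0` if there is none. -/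
noncomputable def transMatrix (𝒜 : NBA A Q) (σ : List A) (q q' : Q) : ℕ∞ :=
  if ∃ x, 𝒜.IsPath σ q q' x ∧ ∃ i, i ≠ 0 ∧ x i ∈ 𝒜.F then ⊤
  else if ∃ x, 𝒜.IsPath σ q q' x then 1
  else 0

/-- The composition `(βγ)(q, q') = max_p (β(q, p) · γ(p, q'))`, where `0 · ∞ = ∞ · 0 = 0`. -/
noncomputable def comp (β γ : Q → Q → ℕ∞) : Q → Q → ℕ∞ :=
  fun q q' => ⨆ p, β q p * γ p q'

/-- The set `δ(A*)` of all transition matrices of finite words. -/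
def Mat (𝒜 : NBA A Q) : Type _ := Set.range 𝒜.transMatrix

/-- The pair `(β, γ)` is rejecting. -/
def Rejecting (𝒜 : NBA A Q) (β γ : Q → Q → ℕ∞) : Prop :=
  comp β γ = β ∧ comp γ γ = γ ∧ ∀ q, 0 < β 𝒜.q₀ q → γ q q < ⊤

/-- The states `{q₀} ∪ δ(A*) ∪ δ(A*)² ∪ δ(A*)³` of the complement automaton. -/
inductive ComplState (𝒜 : NBA A Q)
  | init : ComplState 𝒜
  | one (γ : 𝒜.Mat) : ComplState 𝒜
  | two (γ ζ : 𝒜.Mat) : ComplState 𝒜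
  | three (β γ ζ : 𝒜.Mat) : ComplState 𝒜

/-- The transitions of the complement automaton. -/
inductive ComplStep (𝒜 : NBA A Q) : 𝒜.ComplState → A → 𝒜.ComplState → Prop
  | start (a : A) (β γ ζ : 𝒜.Mat) : 𝒜.Rejecting β.1 γ.1 → ζ.1 = 𝒜.transMatrix [a] →
      ComplStep 𝒜 .init a (.three β γ ζ)
  | threeStep (a : A) (β γ ζ ζ' : 𝒜.Mat) : ζ'.1 = comp ζ.1 (𝒜.transMatrix [a]) →
      ComplStep 𝒜 (.three β γ ζ) a (.three β γ ζ')
  | threeDone (a : A) (β γ ζ : 𝒜.Mat) : comp ζ.1 (𝒜.transMatrix [a]) = β.1 →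
      ComplStep 𝒜 (.three β γ ζ) a (.one γ)
  | oneStep (a : A) (γ ζ : 𝒜.Mat) : ζ.1 = 𝒜.transMatrix [a] →
      ComplStep 𝒜 (.one γ) a (.two γ ζ)
  | twoStep (a : A) (γ ζ ζ' : 𝒜.Mat) : ζ'.1 = comp ζ.1 (𝒜.transMatrix [a]) →
      ComplStep 𝒜 (.two γ ζ) a (.two γ ζ')
  | twoDone (a : A) (γ ζ : 𝒜.Mat) : comp ζ.1 (𝒜.transMatrix [a]) = γ.1 →
      ComplStep 𝒜 (.two γ ζ) a (.one γ)
  | oneDone (a : A) (γ : 𝒜.Mat) : 𝒜.transMatrix [a] = γ.1 →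
      ComplStep 𝒜 (.one γ) a (.one γ)

/-- The complement automaton `𝒜ᶜ`, which guesses a rejecting factorisation of the input. -/
def compl (𝒜 : NBA A Q) : NBA A 𝒜.ComplState where
  δ := {e | 𝒜.ComplStep e.1.1 e.1.2 e.2}
  q₀ := .init
  F := Set.range .one

instance (𝒜 : NBA A Q) [Finite Q] : Finite 𝒜.Mat := by
  have h : (Set.pi Set.univ fun _ : Q => Set.pi Set.univ fun _ : Q =>
      ({0, 1, ⊤} : Set ℕ∞)).Finite :=
    Set.Finite.pi fun _ => Set.Finite.pi fun _ => Set.toFinite _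
  refine Set.Finite.to_subtype (h.subset ?_)
  rintro _ ⟨σ, rfl⟩ q _ q' _
  unfold transMatrix
  split_ifs <;> simp

instance (𝒜 : NBA A Q) [Finite Q] : Finite 𝒜.ComplState := by
  let f : Unit ⊕ 𝒜.Mat ⊕ (𝒜.Mat × 𝒜.Mat) ⊕ (𝒜.Mat × 𝒜.Mat × 𝒜.Mat) → 𝒜.ComplState
    | .inl _ => .init
    | .inr (.inl γ) => .one γ
    | .inr (.inr (.inl p)) => .two p.1 p.2
    | .inr (.inr (.inr p)) => .three p.1 p.2.1 p.2.2
  refine Finite.of_surjective f ?_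
  rintro (_ | γ | ⟨γ, ζ⟩ | ⟨β, γ, ζ⟩)
  · exact ⟨.inl (), rfl⟩
  · exact ⟨.inr (.inl γ), rfl⟩
  · exact ⟨.inr (.inr (.inl (γ, ζ))), rfl⟩
  · exact ⟨.inr (.inr (.inr (β, γ, ζ))), rfl⟩

end Complement

open SOArith in
/-- The closed formula `∀ X ∈ A^ω. (X ∈ L(𝒜ᶜ) ≡ X ∉ L(𝒜))`, where the letters, the states of `𝒜`
and the states of `𝒜ᶜ` are coded by `cA`, `cQ` and `cQc`. -/
noncomputable def complCorrect {A Q : Type*} [Finite A] [Finite Q] (𝒜 : NBA A Q)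
    (cA : A → ℕ) (cQ : Q → ℕ) (cQc : 𝒜.ComplState → ℕ) : Fm 0 0 :=
  .allS (.imp (.isSeq cA 0)
    (.iff (𝒜.compl.inLang cA cQc 0) (.neg (𝒜.inLang cA cQ 0))))

end NBA

namespace SOArith

/-! ### Substitution -/

/-! Fix a model of `RCA0`, possibly nonstandard, and a word in it. Matrices compose along
concatenation (`transMatrix_append`), so δ(A*) is a monoid that is finite in the metatheory; write
c(x, y) for the matrix of the factor [x, y).

No word lies in both languages. An accepting run of the complement automaton cuts the word into
factors with matrices β, γ, γ, …. A run of 𝒜 visits some state q at unboundedly many cuts; if it is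
accepting, it meets F between two of these, so β(q₀, q) > 0 and γ(q, q) = ∞, and (β, γ) is not
rejecting (`not_isAccRun_of_isAccRun_compl`).

Every word lies in one of them. A weak Ramsey theorem (`IsProd.exists_ramsey`) gives an unbounded H
in the model and β, γ with βγ = β, γγ = γ such that c(0, y) = β on H, and for each x in H, c(x, y) =
γ for all large y in H. The step to an exact factorisation is made by the transitions of the
complement automaton: it closes a factor as soon as it stands in H and the product is right. That it
closes a factor beyond every n is a Σ⁰₁ statement, proved by induction on n (`greedy_frequently`).
If (β, γ) is rejecting, this is an accepting run. Otherwise β(q₀, q) > 0 and γ(q, q) = ∞ for some q,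
and recursion builds an accepting run of 𝒜 that is at q at every cut
(`exists_isAccRun_of_factorisation`).

Only Σ⁰₁ induction and Δ⁰₁ comprehension are available. Alphabets, states and matrices are finite
outside the model, so pigeonhole arguments over them cost nothing there. Recursion with values in
such a finite set (`exists_rec₂`) rests on a divisibility coding of bounded sets (`exists_code`).
Definability is tracked by the classes `IsTm`, `Bdd`, `Sig`, so that instance search supplies the
formulae. -/

theorem Tm.eval_subst (M : Str.{u}) {n k : ℕ} (σ : Fin n → Tm k) (ρ : Fin k → M.Num) (t : Tm n) :
    (t.subst σ).eval M ρ = t.eval M (fun i => (σ i).eval M ρ) := by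
  induction t with
  | var i => rfl
  | zero => rfl
  | succ t ih => simp only [Tm.subst, Tm.eval, ih]
  | add s t ihs iht => simp only [Tm.subst, Tm.eval, ihs, iht]
  | mul s t ihs iht => simp only [Tm.subst, Tm.eval, ihs, iht]

theorem Tm.eval_shift (M : Str.{u}) {n : ℕ} (t : Tm n) (a : M.Num) (ρ : Fin n → M.Num) :
    t.shift.eval M (Fin.cons a ρ) = t.eval M ρ := by
  simp only [Tm.shift, Tm.eval_subst, Tm.eval, Fin.cons_succ]

theorem Tm.shift_subst {n k : ℕ} (σ : Fin n → Tm k) (t : Tm n) :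
    t.shift.subst (Fin.cons (.var 0) (fun i => (σ i).shift)) = (t.subst σ).shift := by
  induction t with
  | var i => simp [Tm.shift, Tm.subst]
  | zero => rfl
  | succ t ih => simp only [Tm.shift, Tm.subst] at ih ⊢; rw [ih]
  | add s t ihs iht => simp only [Tm.shift, Tm.subst] at ihs iht ⊢; rw [ihs, iht]
  | mul s t ihs iht => simp only [Tm.shift, Tm.subst] at ihs iht ⊢; rw [ihs, iht]

theorem Fm.realize_subst (M : Str.{u}) {n m k l : ℕ} (φ : Fm n m) (σ : Fin n → Tm k)
    (τ : Fin m → Fin l) (ρ : Fin k → M.Num) (η : Fin l → M.Sets) :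
    (φ.subst σ τ).Realize M ρ η ↔ φ.Realize M (fun i => (σ i).eval M ρ) (fun i => η (τ i)) := by
  have key : ∀ {n k : ℕ} (σ : Fin n → Tm k) (ρ : Fin k → M.Num) (a : M.Num),
      (fun i => ((Fin.cons (.var 0) (fun i => (σ i).shift) : Fin (n + 1) → Tm (k + 1)) i).eval M
        (Fin.cons a ρ)) = (Fin.cons a (fun i => (σ i).eval M ρ) : Fin (n + 1) → M.Num) := by
    intro n k σ ρ a
    funext i
    refine Fin.cases ?_ (fun i => ?_) i
    · simp [Tm.eval]
    · simp [Tm.eval_shift]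
  have keyS : ∀ {m l : ℕ} (τ : Fin m → Fin l) (η : Fin l → M.Sets) (A : M.Sets),
      (fun i => (Fin.cons A η : Fin (l + 1) → M.Sets)
        ((Fin.cons 0 (fun i => (τ i).succ) : Fin (m + 1) → Fin (l + 1)) i)) =
        (Fin.cons A (fun i => η (τ i)) : Fin (m + 1) → M.Sets) := by
    intro m l τ η A
    funext i
    refine Fin.cases ?_ (fun i => ?_) i <;> simp
  induction φ generalizing k l with
  | eq s t => simp only [Fm.subst, Fm.Realize, Tm.eval_subst]
  | lt s t => simp only [Fm.subst, Fm.Realize, Tm.eval_subst]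
  | mem t X => simp only [Fm.subst, Fm.Realize, Tm.eval_subst]
  | neg φ ih => simp only [Fm.subst, Fm.Realize, ih]
  | and φ ψ ih₁ ih₂ => simp only [Fm.subst, Fm.Realize, ih₁, ih₂]
  | or φ ψ ih₁ ih₂ => simp only [Fm.subst, Fm.Realize, ih₁, ih₂]
  | allN φ ih => simp only [Fm.subst, Fm.Realize, ih, key]
  | exN φ ih => simp only [Fm.subst, Fm.Realize, ih, key]
  | allS φ ih => simp only [Fm.subst, Fm.Realize, ih, keyS]
  | exS φ ih => simp only [Fm.subst, Fm.Realize, ih, keyS]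

theorem Fm.Bounded.subst {n m k l : ℕ} {φ : Fm n m} (h : φ.Bounded) (σ : Fin n → Tm k)
    (τ : Fin m → Fin l) : (φ.subst σ τ).Bounded := by
  induction h generalizing k l with
  | eq s t => exact .eq _ _
  | lt s t => exact .lt _ _
  | mem t X => exact .mem _ _
  | neg _ ih => exact .neg (ih _ _)
  | and _ _ ih₁ ih₂ => exact .and (ih₁ _ _) (ih₂ _ _)
  | or _ _ ih₁ ih₂ => exact .or (ih₁ _ _) (ih₂ _ _)
  | ballN t _ ih =>
    simp only [Fm.subst, Fm.imp, Tm.subst, Tm.shift_subst, Fin.cons_zero]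
    exact .ballN _ (ih _ _)
  | bexN t _ ih =>
    simp only [Fm.subst, Tm.subst, Tm.shift_subst, Fin.cons_zero]
    exact .bexN _ (ih _ _)

theorem Fm.Sigma1.subst {n m k l : ℕ} {φ : Fm n m} (h : φ.Sigma1) (σ : Fin n → Tm k)
    (τ : Fin m → Fin l) : (φ.subst σ τ).Sigma1 := by
  induction h generalizing k l with
  | bounded h => exact .bounded (h.subst σ τ)
  | exN _ ih => exact .exN (ih _ _)

theorem Fm.realize_of_closeN {M : Str.{u}} {n m : ℕ} {φ : Fm n m} {η : Fin m → M.Sets}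
    (h : φ.closeN.Realize M Fin.elim0 η) (ρ : Fin n → M.Num) : φ.Realize M ρ η := by
  induction n with
  | zero => rwa [Subsingleton.elim ρ Fin.elim0]
  | succ n ih =>
    have := ih (φ := .allN φ) h (Fin.tail ρ) (ρ 0)
    rwa [Fin.cons_self_tail] at this

theorem Fm.realize_of_closeS {M : Str.{u}} {m : ℕ} {φ : Fm 0 m}
    (h : M.Sat φ.closeS) (η : Fin m → M.Sets) : φ.Realize M Fin.elim0 η := by
  induction m with
  | zero => rwa [Subsingleton.elim η Fin.elim0]
  | succ n ih =>
    have := ih (φ := .allS φ) h (Fin.tail η) (η 0)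
    rwa [Fin.cons_self_tail] at this

theorem Fm.realize_of_close {M : Str.{u}} {n m : ℕ} {φ : Fm n m} (h : M.Sat φ.close)
    (ρ : Fin n → M.Num) (η : Fin m → M.Sets) : φ.Realize M ρ η :=
  realize_of_closeN (realize_of_closeS h η) ρ

/-! ### Definability with parameters -/

section Definability

variable {M : Str.{u}} {n : ℕ}

/-- The assignment that evaluates each of `l` variables either to one of `n` arguments or to a
fixed parameter. -/
def assign {l : ℕ} (e : Fin l → Fin n ⊕ M.Num) (v : Fin n → M.Num) : Fin l → M.Num :=
  fun i => Sum.elim v id (e i)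

theorem assign_append_left {l l' : ℕ} (e : Fin l → Fin n ⊕ M.Num) (e' : Fin l' → Fin n ⊕ M.Num)
    (v : Fin n → M.Num) : (fun i => assign (Fin.append e e') v (Fin.castAdd l' i)) = assign e v := by
  funext i; simp [assign]

theorem assign_append_right {l l' : ℕ} (e : Fin l → Fin n ⊕ M.Num) (e' : Fin l' → Fin n ⊕ M.Num)
    (v : Fin n → M.Num) : (fun i => assign (Fin.append e e') v (Fin.natAdd l i)) = assign e' v := by
  funext i; simp [assign]

/-- The functions given by a term with parameters. -/
class IsTm (f : (Fin n → M.Num) → M.Num) : Prop where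
  out : ∃ (l : ℕ) (t : Tm l) (e : Fin l → Fin n ⊕ M.Num), ∀ v, f v = t.eval M (assign e v)

/-- The relations given by a bounded formula with parameters. -/
class Bdd (P : (Fin n → M.Num) → Prop) : Prop where
  out : ∃ (l m : ℕ) (φ : Fm l m) (e : Fin l → Fin n ⊕ M.Num) (η : Fin m → M.Sets),
    φ.Bounded ∧ ∀ v, P v ↔ φ.Realize M (assign e v) η

/-- The relations given by a `Σ⁰₁` formula with parameters. -/
class Sig (P : (Fin n → M.Num) → Prop) : Prop where
  out : ∃ (l m : ℕ) (φ : Fm l m) (e : Fin l → Fin n ⊕ M.Num) (η : Fin m → M.Sets),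
    φ.Sigma1 ∧ ∀ v, P v ↔ φ.Realize M (assign e v) η

theorem IsTm.merge {f g : (Fin n → M.Num) → M.Num} (hf : IsTm f) (hg : IsTm g) :
    ∃ (l : ℕ) (s t : Tm l) (e : Fin l → Fin n ⊕ M.Num),
      ∀ v, f v = s.eval M (assign e v) ∧ g v = t.eval M (assign e v) := by
  obtain ⟨l, s, e, hs⟩ := hf.out
  obtain ⟨l', t, e', ht⟩ := hg.out
  refine ⟨l + l', s.subst fun i => .var (Fin.castAdd _ i), t.subst fun i => .var (Fin.natAdd _ i),
    Fin.append e e', fun v => ?_⟩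
  simp only [Tm.eval_subst, Tm.eval, assign_append_left, assign_append_right, hs, ht, and_self]

theorem Bdd.merge {P R : (Fin n → M.Num) → Prop} (hP : Bdd P) (hR : Bdd R) :
    ∃ (l m : ℕ) (φ ψ : Fm l m) (e : Fin l → Fin n ⊕ M.Num) (η : Fin m → M.Sets),
      φ.Bounded ∧ ψ.Bounded ∧
        ∀ v, (P v ↔ φ.Realize M (assign e v) η) ∧ (R v ↔ ψ.Realize M (assign e v) η) := by
  obtain ⟨l, m, φ, e, η, hφ, h⟩ := hP.out
  obtain ⟨l', m', ψ, e', η', hψ, h'⟩ := hR.out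
  refine ⟨l + l', m + m', φ.subst (fun i => .var (Fin.castAdd _ i)) (Fin.castAdd _),
    ψ.subst (fun i => .var (Fin.natAdd _ i)) (Fin.natAdd _), Fin.append e e', Fin.append η η',
    hφ.subst _ _, hψ.subst _ _, fun v => ?_⟩
  simp only [Fm.realize_subst, Tm.eval, assign_append_left, assign_append_right, h, h',
    Fin.append_left, Fin.append_right, and_self]

/-- The first argument is made the first variable. -/
def headSubst {l : ℕ} (e : Fin l → Fin (n + 1) ⊕ M.Num) (i : Fin l) : Tm (l + 1) :=
  Sum.elim (Fin.cons (.var 0) fun _ => .var i.succ) (fun _ => .var i.succ) (e i)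

/-- The parameters that remain when the first argument is made the first variable. -/
def headRest {l : ℕ} (e : Fin l → Fin (n + 1) ⊕ M.Num) (i : Fin l) : Fin n ⊕ M.Num :=
  Sum.elim (Fin.cons (.inr M.zero) .inl) .inr (e i)

/-- Quantifiers and axioms act on variable 0, but `e` may send several variables, or none, to the
first argument; the substitution identifies all of them with a fresh variable 0. The value `M.zero`
in `headRest` fills slots that are no longer read. -/
theorem eval_headSubst {l : ℕ} (e : Fin l → Fin (n + 1) ⊕ M.Num) (x : M.Num) (v : Fin n → M.Num) :
    (fun i => (headSubst e i).eval M (Fin.cons x (assign (headRest e) v))) =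
      assign e (Fin.cons x v : Fin (n + 1) → M.Num) := by
  funext i
  unfold headSubst assign headRest
  rcases h : e i with j | c
  · revert h
    refine Fin.cases (fun h => ?_) (fun j h => ?_) j <;> simp [Tm.eval, h]
  · simp [Tm.eval, h]

instance IsTm.var (i : Fin n) : IsTm (M := M) (fun v => v i) :=
  ⟨1, .var 0, fun _ => .inl i, fun _ => rfl⟩

instance IsTm.const (c : M.Num) : IsTm (n := n) (fun _ => c) :=
  ⟨1, .var 0, fun _ => .inr c, fun _ => rfl⟩

theorem assign_tail {l : ℕ} (e : Fin l → Fin n ⊕ M.Num) (w : Fin (n + 1) → M.Num) :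
    assign (fun i => (e i).map Fin.succ id) w = assign e (fun i => w i.succ) := by
  funext i
  unfold assign
  rcases h : e i with j | c <;> simp [h]

/-- Below a quantifier the outer arguments appear as the tail of a longer assignment; this instance
lets the search for a term pass through. -/
instance IsTm.tail (f : (Fin n → M.Num) → M.Num) [hf : IsTm f] :
    IsTm (fun w : Fin (n + 1) → M.Num => f (fun i => w i.succ)) := by
  obtain ⟨l, t, e, h⟩ := hf.out
  exact ⟨l, t, fun i => (e i).map Fin.succ id, fun v => by simp only [h, assign_tail]⟩

theorem IsTm.add' (f g : (Fin n → M.Num) → M.Num) [hf : IsTm f] [hg : IsTm g] :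
    IsTm (fun v => M.add (f v) (g v)) := by
  obtain ⟨l, s, t, e, h⟩ := hf.merge hg
  exact ⟨l, .add s t, e, fun v => by simp only [Tm.eval, h]⟩

theorem IsTm.mul' (f g : (Fin n → M.Num) → M.Num) [hf : IsTm f] [hg : IsTm g] :
    IsTm (fun v => M.mul (f v) (g v)) := by
  obtain ⟨l, s, t, e, h⟩ := hf.merge hg
  exact ⟨l, .mul s t, e, fun v => by simp only [Tm.eval, h]⟩

instance Bdd.eq (f g : (Fin n → M.Num) → M.Num) [hf : IsTm f] [hg : IsTm g] :
    Bdd (fun v => f v = g v) := by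
  obtain ⟨l, s, t, e, h⟩ := hf.merge hg
  exact ⟨l, 0, .eq s t, e, Fin.elim0, .eq _ _, fun v => by simp only [Fm.Realize, h]⟩

theorem Bdd.lt' (f g : (Fin n → M.Num) → M.Num) [hf : IsTm f] [hg : IsTm g] :
    Bdd (fun v => M.lt (f v) (g v)) := by
  obtain ⟨l, s, t, e, h⟩ := hf.merge hg
  exact ⟨l, 0, .lt s t, e, Fin.elim0, .lt _ _, fun v => by simp only [Fm.Realize, h]⟩

instance Bdd.mem (f : (Fin n → M.Num) → M.Num) (A : M.Sets) [hf : IsTm f] :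
    Bdd (fun v => M.mem (f v) A) := by
  obtain ⟨l, t, e, h⟩ := hf.out
  exact ⟨l, 1, .mem t 0, e, fun _ => A, .mem _ _, fun v => by simp only [Fm.Realize, h]⟩

instance Bdd.neg (P : (Fin n → M.Num) → Prop) [hP : Bdd P] : Bdd (fun v => ¬ P v) := by
  obtain ⟨l, m, φ, e, η, hφ, h⟩ := hP.out
  exact ⟨l, m, .neg φ, e, η, .neg hφ, fun v => by simp only [Fm.Realize, h]⟩

instance Bdd.and (P R : (Fin n → M.Num) → Prop) [hP : Bdd P] [hR : Bdd R] :
    Bdd (fun v => P v ∧ R v) := by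
  obtain ⟨l, m, φ, ψ, e, η, hφ, hψ, h⟩ := hP.merge hR
  exact ⟨l, m, .and φ ψ, e, η, .and hφ hψ, fun v => by simp only [Fm.Realize, h]⟩

instance Bdd.or (P R : (Fin n → M.Num) → Prop) [hP : Bdd P] [hR : Bdd R] :
    Bdd (fun v => P v ∨ R v) := by
  obtain ⟨l, m, φ, ψ, e, η, hφ, hψ, h⟩ := hP.merge hR
  exact ⟨l, m, .or φ ψ, e, η, .or hφ hψ, fun v => by simp only [Fm.Realize, h]⟩

instance Bdd.imp (P R : (Fin n → M.Num) → Prop) [hP : Bdd P] [hR : Bdd R] :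
    Bdd (fun v => P v → R v) := by
  have := Bdd.neg P
  simpa only [imp_iff_not_or] using Bdd.or (fun v => ¬ P v) R

instance Bdd.iff (P R : (Fin n → M.Num) → Prop) [hP : Bdd P] [hR : Bdd R] :
    Bdd (fun v => P v ↔ R v) := by
  simp only [iff_def]
  infer_instance

/-- The truth value of `p` is settled outside the model, so a trivially true or trivially false
formula serves. -/
instance Bdd.const (p : Prop) : Bdd (M := M) (n := n) (fun _ => p) := by
  by_cases h : p
  · have : (fun _ : Fin n → M.Num => p) = fun _ => M.zero = M.zero := by simp [h]
    rw [this]; infer_instance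
  · have : (fun _ : Fin n → M.Num => p) = fun _ => ¬ (M.zero = M.zero) := by simp [h]
    rw [this]; infer_instance

theorem Bdd.bex' (t : (Fin n → M.Num) → M.Num) (P : M.Num → (Fin n → M.Num) → Prop) [ht : IsTm t]
    [hP : Bdd (n := n + 1) fun w => P (w 0) (fun i => w i.succ)] :
    Bdd (fun v => ∃ x, M.lt x (t v) ∧ P x v) := by
  obtain ⟨l, m, φ, e, η, hφ, h⟩ := hP.out
  obtain ⟨l', s, e', h'⟩ := ht.out
  refine ⟨l + l', m, .exN (.and (.lt (.var 0) (Tm.shift (s.subst fun i => .var (Fin.natAdd _ i))))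
    (φ.subst (fun i => (headSubst e i).subst
      (Fin.cons (.var 0) fun i => .var (Fin.castAdd l' i).succ)) id)),
    Fin.append (headRest e) e', η, .bexN _ (hφ.subst _ _), fun v => ?_⟩
  simp only [Fm.Realize, Tm.eval_shift, Tm.eval_subst, Tm.eval, Fin.cons_zero, assign_append_right,
    h', Fm.realize_subst, id]
  refine exists_congr fun x => and_congr_right fun _ => ?_
  have := h (Fin.cons x v)
  simp only [Fin.cons_zero, Fin.cons_succ] at this
  rw [this, ← eval_headSubst]
  congr! 3
  funext j
  refine Fin.cases ?_ (fun j => ?_) j <;> simp [Tm.eval, assign]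

theorem Bdd.ball' (t : (Fin n → M.Num) → M.Num) (P : M.Num → (Fin n → M.Num) → Prop) [ht : IsTm t]
    [hP : Bdd (n := n + 1) fun w => P (w 0) (fun i => w i.succ)] :
    Bdd (fun v => ∀ x, M.lt x (t v) → P x v) := by
  have h₁ := Bdd.neg fun w : Fin (n + 1) → M.Num => P (w 0) (fun i => w i.succ)
  have h₂ := Bdd.bex' t (fun x v => ¬ P x v)
  have h₃ := Bdd.neg fun v => ∃ x, M.lt x (t v) ∧ ¬ P x v
  simpa only [not_exists, not_and, not_not] using h₃

/-- As `S` is finite in the metatheory, this is a finite disjunction of formulae and uses no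
quantifier of the model. -/
instance Bdd.exFin {S : Type*} [Finite S] (P : S → (Fin n → M.Num) → Prop) [hP : ∀ s, Bdd (P s)] :
    Bdd (fun v => ∃ s, P s v) := by
  cases nonempty_fintype S
  have key : ∀ l : List S, Bdd (fun v => ∃ s ∈ l, P s v) := by
    intro l
    induction l with
    | nil => simp only [List.not_mem_nil, false_and, exists_false]; infer_instance
    | cons a l ih => simp only [List.mem_cons, exists_eq_or_imp]; infer_instance
  simpa using key Finset.univ.toList

instance Bdd.allFin {S : Type*} [Finite S] (P : S → (Fin n → M.Num) → Prop)
    [hP : ∀ s, Bdd (P s)] : Bdd (fun v => ∀ s, P s v) := by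
  have := Bdd.neg fun v => ∃ s, ¬ P s v
  simpa only [not_exists, not_not] using this

instance Sig.of_bdd (P : (Fin n → M.Num) → Prop) [hP : Bdd P] : Sig P := by
  obtain ⟨l, m, φ, e, η, hφ, h⟩ := hP.out
  exact ⟨l, m, φ, e, η, .bounded hφ, h⟩

instance Sig.ex (P : M.Num → (Fin n → M.Num) → Prop)
    [hP : Sig (n := n + 1) fun w => P (w 0) (fun i => w i.succ)] :
    Sig (fun v => ∃ x, P x v) := by
  obtain ⟨l, m, φ, e, η, hφ, h⟩ := hP.out
  refine ⟨l, m, .exN (φ.subst (headSubst e) id), headRest e, η, .exN (hφ.subst _ _), fun v => ?_⟩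
  simp only [Fm.Realize, Fm.realize_subst, eval_headSubst, id]
  refine exists_congr fun x => ?_
  have := h (Fin.cons x v)
  simp only [Fin.cons_zero, Fin.cons_succ] at this
  exact this

end Definability

/-! ### Conjunctions and disjunctions of `Σ⁰₁` formulae -/

/-- The bounded conjunct is pushed through the existential block, its variables being shifted at
each quantifier. The version for two `Sigma1` formulae exhausts one block in the same way and then
falls back on this one. -/
theorem Fm.Sigma1.exists_and_bounded (M : Str.{u}) {n m : ℕ} {φ : Fm n m} (hφ : φ.Sigma1) :
    ∀ {ψ : Fm n m}, ψ.Bounded → ∃ χ : Fm n m, χ.Sigma1 ∧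
      ∀ ρ η, χ.Realize M ρ η ↔ ψ.Realize M ρ η ∧ φ.Realize M ρ η := by
  induction hφ with
  | bounded h => exact fun hψ => ⟨_, .bounded (.and hψ h), fun _ _ => Iff.rfl⟩
  | exN _ ih =>
    intro ψ hψ
    obtain ⟨χ, hχ, h⟩ := ih (hψ.subst (fun i => .var i.succ) id)
    refine ⟨_, .exN hχ, fun ρ η => ?_⟩
    simp only [Fm.Realize, h, Fm.realize_subst, Tm.eval, Fin.cons_succ, id, exists_and_left]

theorem Fm.Sigma1.exists_and (M : Str.{u}) {n m : ℕ} {φ : Fm n m} (hφ : φ.Sigma1) :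
    ∀ {ψ : Fm n m}, ψ.Sigma1 → ∃ χ : Fm n m, χ.Sigma1 ∧
      ∀ ρ η, χ.Realize M ρ η ↔ φ.Realize M ρ η ∧ ψ.Realize M ρ η := by
  induction hφ with
  | bounded h => exact fun hψ => hψ.exists_and_bounded M h
  | exN _ ih =>
    intro ψ hψ
    obtain ⟨χ, hχ, h⟩ := ih (hψ.subst (fun i => .var i.succ) id)
    refine ⟨_, .exN hχ, fun ρ η => ?_⟩
    simp only [Fm.Realize, h, Fm.realize_subst, Tm.eval, Fin.cons_succ, id, exists_and_right]

theorem Fm.Sigma1.exists_or_bounded (M : Str.{u}) {n m : ℕ} {φ : Fm n m} (hφ : φ.Sigma1) :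
    ∀ {ψ : Fm n m}, ψ.Bounded → ∃ χ : Fm n m, χ.Sigma1 ∧
      ∀ ρ η, χ.Realize M ρ η ↔ ψ.Realize M ρ η ∨ φ.Realize M ρ η := by
  have : Nonempty M.Num := ⟨M.zero⟩
  induction hφ with
  | bounded h => exact fun hψ => ⟨_, .bounded (.or hψ h), fun _ _ => Iff.rfl⟩
  | exN _ ih =>
    intro ψ hψ
    obtain ⟨χ, hχ, h⟩ := ih (hψ.subst (fun i => .var i.succ) id)
    refine ⟨_, .exN hχ, fun ρ η => ?_⟩
    simp only [Fm.Realize, h, Fm.realize_subst, Tm.eval, Fin.cons_succ, id, _root_.exists_or, exists_const]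

theorem Fm.Sigma1.exists_or (M : Str.{u}) {n m : ℕ} {φ : Fm n m} (hφ : φ.Sigma1) :
    ∀ {ψ : Fm n m}, ψ.Sigma1 → ∃ χ : Fm n m, χ.Sigma1 ∧
      ∀ ρ η, χ.Realize M ρ η ↔ φ.Realize M ρ η ∨ ψ.Realize M ρ η := by
  have : Nonempty M.Num := ⟨M.zero⟩
  induction hφ with
  | bounded h => exact fun hψ => hψ.exists_or_bounded M h
  | exN _ ih =>
    intro ψ hψ
    obtain ⟨χ, hχ, h⟩ := ih (hψ.subst (fun i => .var i.succ) id)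
    refine ⟨_, .exN hχ, fun ρ η => ?_⟩
    simp only [Fm.Realize, h, Fm.realize_subst, Tm.eval, Fin.cons_succ, id, _root_.exists_or, exists_const]

section Sig

variable {M : Str.{u}} {n : ℕ}

theorem Sig.merge {P R : (Fin n → M.Num) → Prop} (hP : Sig P) (hR : Sig R) :
    ∃ (l m : ℕ) (φ ψ : Fm l m) (e : Fin l → Fin n ⊕ M.Num) (η : Fin m → M.Sets),
      φ.Sigma1 ∧ ψ.Sigma1 ∧
        ∀ v, (P v ↔ φ.Realize M (assign e v) η) ∧ (R v ↔ ψ.Realize M (assign e v) η) := by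
  obtain ⟨l, m, φ, e, η, hφ, h⟩ := hP.out
  obtain ⟨l', m', ψ, e', η', hψ, h'⟩ := hR.out
  refine ⟨l + l', m + m', φ.subst (fun i => .var (Fin.castAdd _ i)) (Fin.castAdd _),
    ψ.subst (fun i => .var (Fin.natAdd _ i)) (Fin.natAdd _), Fin.append e e', Fin.append η η',
    hφ.subst _ _, hψ.subst _ _, fun v => ?_⟩
  simp only [Fm.realize_subst, Tm.eval, assign_append_left, assign_append_right, h, h',
    Fin.append_left, Fin.append_right, and_self]

instance Sig.and (P R : (Fin n → M.Num) → Prop) [hP : Sig P] [hR : Sig R] :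
    Sig (fun v => P v ∧ R v) := by
  obtain ⟨l, m, φ, ψ, e, η, hφ, hψ, h⟩ := hP.merge hR
  obtain ⟨χ, hχ, h'⟩ := hφ.exists_and M hψ
  exact ⟨l, m, χ, e, η, hχ, fun v => by simp only [h, h']⟩

instance Sig.or (P R : (Fin n → M.Num) → Prop) [hP : Sig P] [hR : Sig R] :
    Sig (fun v => P v ∨ R v) := by
  obtain ⟨l, m, φ, ψ, e, η, hφ, hψ, h⟩ := hP.merge hR
  obtain ⟨χ, hχ, h'⟩ := hφ.exists_or M hψ
  exact ⟨l, m, χ, e, η, hχ, fun v => by simp only [h, h']⟩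

instance Sig.exFin {S : Type*} [Finite S] (P : S → (Fin n → M.Num) → Prop)
    [hP : ∀ s, Sig (P s)] : Sig (fun v => ∃ s, P s v) := by
  cases nonempty_fintype S
  have key : ∀ l : List S, Sig (fun v => ∃ s ∈ l, P s v) := by
    intro l
    induction l with
    | nil => simp only [List.not_mem_nil, false_and, exists_false]; infer_instance
    | cons a l ih => simp only [List.mem_cons, exists_eq_or_imp]; infer_instance
  simpa using key Finset.univ.toList

end Sig

/-! ### Models of `RCA₀` -/

/-- `M` is a model of `RCA₀`. -/
class IsModel (M : Str.{u}) : Prop where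
  sat : ∀ ψ ∈ RCA0, M.Sat ψ

section Axioms

variable {M : Str.{u}} [hM : IsModel M]

theorem succ_induction' (P : M.Num → Prop) [hP : Sig fun v : Fin 1 → M.Num => P (v 0)]
    (zero : P M.zero) (succ : ∀ x, P x → P (M.succ x)) (x : M.Num) : P x := by
  obtain ⟨l, m, φ, e, η, hφ, h⟩ := hP.out
  have h' : ∀ x, P x ↔
      (φ.subst (headSubst e) id).Realize M (Fin.cons x (assign (headRest e) Fin.elim0)) η := by
    intro x
    rw [Fm.realize_subst, eval_headSubst]
    exact h (Fin.cons x Fin.elim0)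
  have ax := Fm.realize_of_close (hM.sat _ (.induction _ (hφ.subst (headSubst e) id)))
    (assign (headRest e) Fin.elim0) η
  simp only [inductionAx, Fm.imp, Fm.Realize] at ax
  rw [← imp_iff_not_or] at ax
  rw [h']
  refine ax ⟨?_, fun x => ?_⟩ x
  · rw [Fm.realize_subst]
    simp only [id]
    convert (h' _).1 zero using 1
    funext i
    refine Fin.cases ?_ (fun i => ?_) i <;> simp [Tm.eval]
  · rw [← imp_iff_not_or, ← h', Fm.realize_subst]
    intro hx
    simp only [id]
    convert (h' _).1 (succ x hx) using 1
    funext i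
    refine Fin.cases ?_ (fun i => ?_) i <;> simp [Tm.eval]

theorem comprehension (P R : M.Num → Prop) [hP : Sig fun v : Fin 1 → M.Num => P (v 0)]
    [hR : Sig fun v : Fin 1 → M.Num => R (v 0)] (hPR : ∀ x, P x ↔ ¬ R x) :
    ∃ A : M.Sets, ∀ x, M.mem x A ↔ P x := by
  obtain ⟨l, m, φ, e, η, hφ, h⟩ := hP.out
  obtain ⟨l', m', ψ, e', η', hψ, h'⟩ := hR.out
  -- Both formulae must live in one context: they share variable 0 and keep disjoint blocks of
  -- number and set parameters.
  have ax := Fm.realize_of_close (hM.sat _ (.comprehension _ _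
    (hφ.subst (fun i => (headSubst e i).subst
      (Fin.cons (.var 0) fun i => .var (Fin.castAdd l' i).succ)) (Fin.castAdd m'))
    (hψ.subst (fun i => (headSubst e' i).subst
      (Fin.cons (.var 0) fun i => .var (Fin.natAdd l i).succ)) (Fin.natAdd m))))
    (assign (Fin.append (headRest e) (headRest e')) Fin.elim0) (Fin.append η η')
  have e₁ : ∀ x, (fun i => (headSubst e i).eval M fun j => Tm.eval M
      (Fin.cons x (assign (Fin.append (headRest e) (headRest e')) Fin.elim0))
      ((Fin.cons (.var 0) fun i => .var (Fin.castAdd l' i).succ : Fin (l + 1) → Tm (l + l' + 1)) j))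
        = assign e (Fin.cons x Fin.elim0) := by
    intro x
    rw [← eval_headSubst]
    congr! 3 with i j
    refine Fin.cases ?_ (fun j => ?_) j <;> simp [Tm.eval, assign]
  have e₂ : ∀ x, (fun i => (headSubst e' i).eval M fun j => Tm.eval M
      (Fin.cons x (assign (Fin.append (headRest e) (headRest e')) Fin.elim0))
      ((Fin.cons (.var 0) fun i => .var (Fin.natAdd l i).succ : Fin (l' + 1) → Tm (l + l' + 1)) j))
        = assign e' (Fin.cons x Fin.elim0) := by
    intro x
    rw [← eval_headSubst]
    congr! 3 with i j
    refine Fin.cases ?_ (fun j => ?_) j <;> simp [Tm.eval, assign]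
  simp only [comprehensionAx, Fm.imp, Fm.iff, Fm.Realize, Fm.realize_subst, Tm.eval, Tm.eval_subst,
    e₁, e₂, ← imp_iff_not_or, Fin.append_left, Fin.append_right, Fin.cons_zero, Fin.cons_succ,
    ← iff_def] at ax
  obtain ⟨A, hA⟩ := ax fun x => by
    rw [← h, ← h']
    exact hPR x
  exact ⟨A, fun x => (hA x).trans (h (Fin.cons x Fin.elim0)).symm⟩

end Axioms

end SOArith

namespace SOArith

/-! ### Arithmetic in models of `RCA₀` -/

section Arithmetic

variable {M : Str.{u}}

instance : Zero M.Num := ⟨M.zero⟩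
instance : One M.Num := ⟨M.succ M.zero⟩
instance : Add M.Num := ⟨M.add⟩
instance : Mul M.Num := ⟨M.mul⟩
instance : LT M.Num := ⟨M.lt⟩
-- The language has no ≤; with this choice the order is canonical by definition.
instance : LE M.Num := ⟨fun x y => ∃ z, y = x + z⟩

instance IsTm.add {n : ℕ} (f g : (Fin n → M.Num) → M.Num) [IsTm f] [IsTm g] :
    IsTm (fun v => f v + g v) := .add' f g

instance IsTm.mul {n : ℕ} (f g : (Fin n → M.Num) → M.Num) [IsTm f] [IsTm g] :
    IsTm (fun v => f v * g v) := .mul' f g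

instance Bdd.lt {n : ℕ} (f g : (Fin n → M.Num) → M.Num) [IsTm f] [IsTm g] :
    Bdd (fun v => f v < g v) := .lt' f g

namespace Num

variable [hM : IsModel M]

section Laws

theorem succ_ne_zero (x : M.Num) : M.succ x ≠ 0 := hM.sat _ (.robinson .q1) x

theorem succ_inj {x y : M.Num} (h : M.succ x = M.succ y) : x = y := by
  have := hM.sat _ (.robinson .q2) x y
  exact imp_iff_not_or.2 this h

theorem exists_eq_succ {x : M.Num} (h : x ≠ 0) : ∃ y, x = M.succ y := by
  have := hM.sat _ (.robinson .q3) x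
  exact imp_iff_not_or.2 this h

theorem add_zero' (x : M.Num) : x + 0 = x := hM.sat _ (.robinson .q4) x

theorem add_succ (x y : M.Num) : x + M.succ y = M.succ (x + y) := hM.sat _ (.robinson .q5) x y

theorem mul_zero' (x : M.Num) : x * 0 = 0 := hM.sat _ (.robinson .q6) x

theorem mul_succ (x y : M.Num) : x * M.succ y = x * y + x := hM.sat _ (.robinson .q7) x y

theorem lt_iff (x y : M.Num) : x < y ↔ ∃ z, x + M.succ z = y := by
  obtain ⟨h₁, h₂⟩ := hM.sat _ (.robinson .q8) x y
  exact ⟨imp_iff_not_or.2 h₁, imp_iff_not_or.2 h₂⟩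

theorem succ_eq_add_one (x : M.Num) : M.succ x = x + 1 := by
  rw [show (1 : M.Num) = M.succ 0 from rfl, add_succ, add_zero']

theorem induction (P : M.Num → Prop) [Sig fun v : Fin 1 → M.Num => P (v 0)]
    (zero : P 0) (succ : ∀ x, P x → P (x + 1)) (x : M.Num) : P x :=
  succ_induction' P zero (fun x hx => succ_eq_add_one x ▸ succ x hx) x

theorem add_add_one (x y : M.Num) : x + (y + 1) = x + y + 1 := by
  rw [← succ_eq_add_one, add_succ, succ_eq_add_one]

theorem mul_add_one' (x y : M.Num) : x * (y + 1) = x * y + x := by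
  rw [← succ_eq_add_one, mul_succ]

theorem zero_add' (x : M.Num) : 0 + x = x := by
  refine induction (fun x => (0 : M.Num) + x = x) (add_zero' 0) (fun x hx => ?_) x
  rw [add_add_one, hx]

theorem add_assoc' (x y z : M.Num) : x + y + z = x + (y + z) := by
  refine induction (fun z => x + y + z = x + (y + z)) ?_ (fun z hz => ?_) z
  · rw [add_zero', add_zero']
  · rw [add_add_one, add_add_one, add_add_one, hz]

theorem add_one_add (x y : M.Num) : x + 1 + y = x + y + 1 := by
  refine induction (fun y => x + 1 + y = x + y + 1) ?_ (fun y hy => ?_) y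
  · rw [add_zero', add_zero']
  · rw [add_add_one, hy, add_add_one]

theorem add_comm' (x y : M.Num) : x + y = y + x := by
  refine induction (fun y => x + y = y + x) ?_ (fun y hy => ?_) y
  · rw [add_zero', zero_add']
  · rw [add_add_one, hy, add_one_add]

theorem mul_add' (x y z : M.Num) : x * (y + z) = x * y + x * z := by
  refine induction (fun z => x * (y + z) = x * y + x * z) ?_ (fun z hz => ?_) z
  · rw [add_zero', mul_zero', add_zero']
  · rw [add_add_one, mul_add_one', hz, mul_add_one', add_assoc']

theorem mul_assoc' (x y z : M.Num) : x * y * z = x * (y * z) := by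
  refine induction (fun z => x * y * z = x * (y * z)) ?_ (fun z hz => ?_) z
  · rw [mul_zero', mul_zero', mul_zero']
  · rw [mul_add_one', hz, mul_add_one', mul_add']

theorem zero_mul' (x : M.Num) : 0 * x = 0 := by
  refine induction (fun x => (0 : M.Num) * x = 0) (mul_zero' 0) (fun x hx => ?_) x
  rw [mul_add_one', hx, add_zero']

theorem add_one_mul' (x y : M.Num) : (x + 1) * y = x * y + y := by
  refine induction (fun y => (x + 1) * y = x * y + y) ?_ (fun y hy => ?_) y
  · rw [mul_zero', mul_zero', add_zero']
  · rw [mul_add_one', hy, mul_add_one', add_add_one, add_add_one, add_assoc' _ y x,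
      add_assoc' _ x y, add_comm' y x]

theorem mul_comm' (x y : M.Num) : x * y = y * x := by
  refine induction (fun y => x * y = y * x) ?_ (fun y hy => ?_) y
  · rw [mul_zero', zero_mul']
  · rw [mul_add_one', hy, add_one_mul']

theorem mul_one' (x : M.Num) : x * 1 = x := by
  have := mul_add_one' x 0
  rwa [zero_add', mul_zero', zero_add'] at this

noncomputable instance : CommSemiring M.Num where
  add_assoc := add_assoc'
  zero_add := zero_add'
  add_zero := add_zero'
  add_comm := add_comm'
  mul_assoc := mul_assoc'
  one_mul x := by rw [mul_comm', mul_one']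
  mul_one := mul_one'
  left_distrib := mul_add'
  right_distrib x y z := by rw [mul_comm', mul_add', mul_comm' z x, mul_comm' z y]
  zero_mul := zero_mul'
  mul_zero := mul_zero'
  mul_comm := mul_comm'
  nsmul := nsmulRec

theorem add_one_inj {x y : M.Num} (h : x + 1 = y + 1) : x = y := by
  rw [← succ_eq_add_one, ← succ_eq_add_one] at h
  exact succ_inj h

theorem add_one_ne_zero (x : M.Num) : x + 1 ≠ 0 := by
  rw [← succ_eq_add_one]; exact succ_ne_zero x

theorem exists_eq_add_one {x : M.Num} (h : x ≠ 0) : ∃ y, x = y + 1 := by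
  obtain ⟨y, hy⟩ := exists_eq_succ h
  exact ⟨y, hy.trans (succ_eq_add_one y)⟩

theorem lt_iff_exists (x y : M.Num) : x < y ↔ ∃ z, y = x + (z + 1) := by
  simp only [lt_iff, succ_eq_add_one, eq_comm]

theorem add_right_cancel' {x y : M.Num} (z : M.Num) : x + z = y + z → x = y := by
  refine induction (fun z => x + z = y + z → x = y) ?_ (fun z hz h => ?_) z
  · simp
  · rw [← add_assoc, ← add_assoc] at h
    exact hz (add_one_inj h)

instance : IsCancelAdd M.Num :=
  have h : ∀ x y z : M.Num, x + y = x + z → y = z := fun x y z h => by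
    rw [add_comm x, add_comm x] at h
    exact add_right_cancel' x h
  { add_left_cancel := h
    add_right_cancel := fun x y z h => add_right_cancel' x h }

theorem eq_zero_of_add_eq_zero {x y : M.Num} (h : x + y = 0) : y = 0 := by
  by_contra hy
  obtain ⟨z, rfl⟩ := exists_eq_add_one hy
  rw [← add_assoc] at h
  exact add_one_ne_zero _ h

theorem zero_le' (x : M.Num) : 0 ≤ x := ⟨x, (zero_add x).symm⟩

theorem le_total' (x y : M.Num) : x ≤ y ∨ y ≤ x := by
  have : ∀ x y : M.Num, (∃ z, y = x + z ∨ x = y + z) := fun x y => by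
    refine induction (fun y => ∃ z, y = x + z ∨ x = y + z) ⟨x, .inr (zero_add x).symm⟩ ?_ y
    rintro y ⟨z, rfl | rfl⟩
    · exact ⟨z + 1, .inl (add_assoc _ _ _)⟩
    · by_cases hz : z = 0
      · exact ⟨1, .inl (by rw [hz, add_zero])⟩
      · obtain ⟨w, rfl⟩ := exists_eq_add_one hz
        exact ⟨w, .inr (by ring)⟩
  obtain ⟨z, h | h⟩ := this x y
  exacts [.inl ⟨z, h⟩, .inr ⟨z, h⟩]

theorem le_antisymm' {x y : M.Num} (h : x ≤ y) (h' : y ≤ x) : x = y := by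
  obtain ⟨z, rfl⟩ := h
  obtain ⟨w, hw⟩ := h'
  have : z + w = 0 := by
    apply add_left_cancel (a := x)
    rw [← add_assoc, ← hw, add_zero]
  rw [add_comm] at this
  rw [eq_zero_of_add_eq_zero this, add_zero]

theorem lt_iff_le_not_ge' (x y : M.Num) : x < y ↔ x ≤ y ∧ ¬ y ≤ x := by
  rw [lt_iff_exists]
  constructor
  · rintro ⟨z, rfl⟩
    refine ⟨⟨_, rfl⟩, ?_⟩
    rintro ⟨w, hw⟩
    have : w + z + 1 = 0 := by
      apply add_left_cancel (a := x)
      rw [add_zero]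
      conv_rhs => rw [hw]
      ring
    exact add_one_ne_zero _ this
  · rintro ⟨⟨z, rfl⟩, h⟩
    have hz : z ≠ 0 := by
      rintro rfl
      exact h ⟨0, by simp⟩
    obtain ⟨w, rfl⟩ := exists_eq_add_one hz
    exact ⟨w, rfl⟩

noncomputable instance : LinearOrder M.Num where
  le_refl x := ⟨0, (add_zero x).symm⟩
  le_trans := by
    rintro x _ _ ⟨z, rfl⟩ ⟨w, rfl⟩
    exact ⟨z + w, add_assoc _ _ _⟩
  lt_iff_le_not_ge := lt_iff_le_not_ge'
  le_antisymm _ _ := le_antisymm'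
  le_total := le_total'
  toDecidableLE := Classical.decRel _

instance : CanonicallyOrderedAdd M.Num where
  exists_add_of_le h := h
  le_add_self _ y := ⟨y, add_comm _ _⟩
  le_self_add _ y := ⟨y, rfl⟩

instance : Nontrivial M.Num := ⟨0, 1, fun h => add_one_ne_zero (0 : M.Num) (by rw [zero_add, ← h])⟩

theorem lt_add_one_iff' {x y : M.Num} : x < y + 1 ↔ x ≤ y := by
  rw [lt_iff_exists, show x ≤ y ↔ ∃ z, y = x + z from Iff.rfl]
  refine exists_congr fun z => ?_
  rw [← add_assoc]
  exact add_left_inj 1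

instance : IsOrderedCancelAddMonoid M.Num where
  add_le_add_left := by
    rintro x _ ⟨z, rfl⟩ w
    exact ⟨z, by ring⟩
  le_of_add_le_add_left := by
    rintro x y z ⟨w, hw⟩
    exact ⟨w, add_left_cancel (a := x) (by rw [hw, add_assoc])⟩

theorem mul_lt_mul_left_of_pos {x y z : M.Num} (hx : 0 < x) (h : y < z) : x * y < x * z := by
  rw [lt_iff_exists] at *
  obtain ⟨a, ha⟩ := hx
  obtain ⟨b, rfl⟩ := h
  rw [zero_add] at ha
  exact ⟨a * b + a + b, by rw [ha]; ring⟩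

instance : IsStrictOrderedRing M.Num where
  zero_le_one := zero_le' 1
  mul_lt_mul_of_pos_left _ hx _ _ h := mul_lt_mul_left_of_pos hx h
  mul_lt_mul_of_pos_right x hx y z h := by
    change y * x < z * x
    rw [mul_comm y, mul_comm z]
    exact mul_lt_mul_left_of_pos hx h

end Laws

end Num

end Arithmetic

end SOArith

namespace SOArith

section FinBdd

variable {M : Str.{u}} {n : ℕ} {S T : Type*}

/-! ### Definable functions into finite sets -/

/-- A function into a finite set whose fibres are given by bounded formulae. -/
class FinBdd (f : (Fin n → M.Num) → S) : Prop where
  out : ∀ s, Bdd fun v => f v = s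

instance Bdd.fin_eq (f : (Fin n → M.Num) → S) (s : S) [hf : FinBdd f] : Bdd (fun v => f v = s) :=
  hf.out s

instance FinBdd.const (s : S) : FinBdd (M := M) (n := n) (fun _ => s) :=
  ⟨fun _ => inferInstance⟩

/-- `U` need not be definable in any sense: the formula is the disjunction over the finitely many
values that satisfy it. -/
theorem Bdd.pred [Finite S] (U : S → Prop) (f : (Fin n → M.Num) → S) [FinBdd f] :
    Bdd (fun v => U (f v)) := by
  have : Bdd (fun v => ∃ s, f v = s ∧ U s) := inferInstance
  simpa only [exists_eq_left'] using this

instance FinBdd.pair (f : (Fin n → M.Num) → S) (g : (Fin n → M.Num) → T) [FinBdd f] [FinBdd g] :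
    FinBdd (fun v => (f v, g v)) := by
  refine ⟨fun s => ?_⟩
  simp only [Prod.ext_iff]
  infer_instance

instance Bdd.finBdd_eq [Finite S] (f g : (Fin n → M.Num) → S) [FinBdd f] [FinBdd g] :
    Bdd (fun v => f v = g v) :=
  .pred (fun p : S × S => p.1 = p.2) fun v => (f v, g v)

theorem FinBdd.map [Finite S] (h : S → T) (f : (Fin n → M.Num) → S) [FinBdd f] :
    FinBdd (fun v => h (f v)) :=
  ⟨fun t => Bdd.pred (fun s => h s = t) f⟩

theorem FinBdd.map₂ {U : Type*} [Finite S] [Finite T] (h : S → T → U) (f : (Fin n → M.Num) → S)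
    (g : (Fin n → M.Num) → T) [FinBdd f] [FinBdd g] : FinBdd (fun v => h (f v) (g v)) :=
  FinBdd.map (fun p : S × T => h p.1 p.2) fun v => (f v, g v)

instance FinBdd.ite (p : (Fin n → M.Num) → Prop) [∀ v, Decidable (p v)]
    (f g : (Fin n → M.Num) → S) [Bdd p] [FinBdd f] [FinBdd g] :
    FinBdd (fun v => if p v then f v else g v) := by
  refine ⟨fun s => ?_⟩
  have : Bdd fun v => (p v ∧ f v = s) ∨ (¬ p v ∧ g v = s) := inferInstance
  convert this using 2 with v
  split_ifs with h <;> simp [h]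

end FinBdd

section Coding

variable {M : Str.{u}} [hM : IsModel M] {n : ℕ}

/-! ### More bounded relations -/

instance Bdd.bex (t : (Fin n → M.Num) → M.Num) (P : M.Num → (Fin n → M.Num) → Prop) [IsTm t]
    [Bdd (n := n + 1) fun w => P (w 0) (fun i => w i.succ)] :
    Bdd (fun v => ∃ x, x < t v ∧ P x v) := .bex' t P

instance Bdd.ball (t : (Fin n → M.Num) → M.Num) (P : M.Num → (Fin n → M.Num) → Prop) [IsTm t]
    [Bdd (n := n + 1) fun w => P (w 0) (fun i => w i.succ)] :
    Bdd (fun v => ∀ x, x < t v → P x v) := .ball' t P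

instance Bdd.le (f g : (Fin n → M.Num) → M.Num) [IsTm f] [IsTm g] :
    Bdd (fun v => f v ≤ g v) := by
  simp only [← not_lt]
  infer_instance

/-- Bounding the quotient makes divisibility a bounded relation. For `x = 0` the quotient is
arbitrary, so 0 is taken. -/
theorem Num.dvd_iff_exists_lt (x y : M.Num) : x ∣ y ↔ ∃ z, z < y + 1 ∧ y = x * z := by
  constructor
  · rintro ⟨z, rfl⟩
    rcases eq_or_ne x 0 with rfl | hx
    · exact ⟨0, by rw [zero_mul, zero_add]; exact zero_lt_one, by simp⟩
    · obtain ⟨w, rfl⟩ := Num.exists_eq_add_one hx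
      refine ⟨z, Num.lt_add_one_iff'.2 ⟨w * z, by ring⟩, rfl⟩
  · rintro ⟨z, -, h⟩
    exact ⟨z, h⟩

instance Bdd.dvd (f g : (Fin n → M.Num) → M.Num) [IsTm f] [IsTm g] :
    Bdd (fun v => f v ∣ g v) := by
  simp only [Num.dvd_iff_exists_lt]
  infer_instance

/-! ### Pairs -/

/-- The pairing function `(x + y)² + x`. -/
def pair (x y : M.Num) : M.Num := (x + y) * (x + y) + x

instance IsTm.pair (f g : (Fin n → M.Num) → M.Num) [IsTm f] [IsTm g] :
    IsTm (fun v => pair (f v) (g v)) := by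
  unfold SOArith.pair
  infer_instance

theorem pair_mono {x y x' y' : M.Num} (hx : x ≤ x') (hy : y ≤ y') : pair x y ≤ pair x' y' := by
  unfold pair
  gcongr

/-- The gap between consecutive squares s² and (s + 1)² is larger than x ≤ s, so pairs are ordered
by their sum first. -/
theorem pair_lt_of_add_lt {x y x' y' : M.Num} (h : x + y < x' + y') : pair x y < pair x' y' := by
  obtain ⟨z, hz⟩ := (Num.lt_iff_exists _ _).1 h
  unfold pair
  rw [hz, Num.lt_iff_exists]
  refine ⟨z * z + 2 * z * (x + y) + 2 * z + y + (x + y) + x', by ring⟩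

theorem pair_inj {x y x' y' : M.Num} : pair x y = pair x' y' ↔ x = x' ∧ y = y' := by
  refine ⟨fun h => ?_, by rintro ⟨rfl, rfl⟩; rfl⟩
  rcases lt_trichotomy (x + y) (x' + y') with h' | h' | h'
  · exact absurd h (pair_lt_of_add_lt h').ne
  · have hx : x = x' := by
      unfold pair at h
      rw [h'] at h
      exact add_left_cancel h
    subst hx
    exact ⟨rfl, add_left_cancel h'⟩
  · exact absurd h (pair_lt_of_add_lt h').ne'

theorem le_pair_left (x y : M.Num) : x ≤ pair x y := by
  unfold pair
  exact le_add_self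

theorem le_pair_right (x y : M.Num) : y ≤ pair x y := by
  rcases eq_or_ne y 0 with rfl | hy
  · exact Num.zero_le' _
  · obtain ⟨z, rfl⟩ := Num.exists_eq_add_one hy
    exact ⟨(x + z) * (x + z) + x + x + z + x, by unfold pair; ring⟩

/-! ### Coding of bounded sets -/

/-- `i` is an element of the set coded by `a` and `b`. -/
def code (a b i : M.Num) : Prop := 1 + (i + 1) * b ∣ a

instance Bdd.code (f g h : (Fin n → M.Num) → M.Num) [IsTm f] [IsTm g] [IsTm h] :
    Bdd (fun v => code (f v) (g v) (h v)) := by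
  unfold SOArith.code
  infer_instance

/-- Replaces subtraction, which the semiring lacks. -/
theorem Num.dvd_of_dvd_add {u x y : M.Num} (h : u ∣ x + y) (hx : u ∣ x) : u ∣ y := by
  obtain ⟨a, rfl⟩ := hx
  obtain ⟨b, hb⟩ := h
  rcases le_total a b with ⟨c, rfl⟩ | ⟨c, rfl⟩
  · exact ⟨c, add_left_cancel (hb.trans (mul_add _ _ _))⟩
  · have : u * b + (u * c + y) = u * b + 0 := by rw [← add_assoc, ← mul_add, hb, add_zero]
    rw [Num.eq_zero_of_add_eq_zero (add_left_cancel this)]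
    exact dvd_zero _

theorem exists_pos_forall_dvd (n : M.Num) : ∃ b : M.Num, 0 < b ∧ ∀ i, i < n → i + 1 ∣ b := by
  refine Num.induction (fun n => ∃ b : M.Num, 0 < b ∧ ∀ i, i < n → i + 1 ∣ b) ?_ ?_ n
  · exact ⟨1, zero_lt_one, fun i hi => absurd hi (Num.zero_le' i).not_gt⟩
  · rintro n ⟨b, hb, h⟩
    refine ⟨b * (n + 1), mul_pos hb (pos_iff_ne_zero.2 (Num.add_one_ne_zero n)), fun i hi => ?_⟩
    rcases (Num.lt_add_one_iff'.1 hi).lt_or_eq with hi | rfl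
    · exact (h i hi).mul_right _
    · exact dvd_mul_left _ _

/-- The moduli u_i = 1 + (i + 1)b behave as coprime numbers. Comparing a·u_j with a·u_i shows that
u_i divides a(d + 1)b with d + 1 = |i − j|; since d + 1 divides b, it divides ab². As (i + 1)b is −1
modulo u_i, the factors b can be cancelled one after the other. -/
theorem code_of_code_mul {a b i j n : M.Num} (hb : ∀ i, i < n → i + 1 ∣ b) (hi : i < n)
    (hj : j < n) (hij : i ≠ j) (h : code (a * (1 + (j + 1) * b)) b i) : code a b i := by
  unfold code at *
  set u := 1 + (i + 1) * b with hu
  have key : ∃ d, d + 1 ≤ n ∧ u ∣ a * (d + 1) * b := by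
    rcases hij.lt_or_gt with hij | hij
    · obtain ⟨d, rfl⟩ := (Num.lt_iff_exists _ _).1 hij
      refine ⟨d, le_trans le_add_self hj.le, Num.dvd_of_dvd_add (x := a * u) ?_ (dvd_mul_left _ _)⟩
      convert h using 1
      rw [hu]
      ring
    · obtain ⟨d, rfl⟩ := (Num.lt_iff_exists _ _).1 hij
      refine ⟨d, le_trans le_add_self hi.le, Num.dvd_of_dvd_add ?_ h⟩
      refine ⟨a, ?_⟩
      rw [hu]
      ring
  obtain ⟨d, hd, h₁⟩ := key
  obtain ⟨k, hk⟩ := hb d (lt_of_lt_of_le (Num.lt_add_one_iff'.2 le_rfl) hd)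
  have h₂ : u ∣ a * b * b := by
    have := h₁.mul_right k
    convert this using 1
    conv_lhs => rw [hk]
    conv_rhs => rw [hk]
    ring
  have h₃ : u ∣ a * b := by
    refine Num.dvd_of_dvd_add (x := a * b * b * (i + 1)) ?_ (h₂.mul_right _)
    exact ⟨a * b, by rw [hu]; ring⟩
  refine Num.dvd_of_dvd_add (x := a * b * (i + 1)) ?_ (h₃.mul_right _)
  exact ⟨a, by rw [hu]; ring⟩

theorem comprehension_of_bdd (P : M.Num → Prop) [Bdd fun v : Fin 1 → M.Num => P (v 0)] :
    ∃ A : M.Sets, ∀ x, M.mem x A ↔ P x :=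
  comprehension P (fun x => ¬ P x) fun _ => not_not.symm

theorem exists_code (P : M.Num → Prop) [Bdd fun v : Fin 1 → M.Num => P (v 0)] (n : M.Num) :
    ∃ a b : M.Num, ∀ i, i < n → (code a b i ↔ P i) := by
  obtain ⟨b, hb₀, hb⟩ := exists_pos_forall_dvd n
  -- The hypothesis covers `P` at a single variable only, whereas membership in `A` is a bounded
  -- relation at every term.
  obtain ⟨A, hA⟩ := comprehension_of_bdd P
  suffices h : ∀ y, ∃ a, ∀ i, i < n → (code a b i ↔ i < y ∧ M.mem i A) by
    obtain ⟨a, ha⟩ := h n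
    exact ⟨a, b, fun i hi => by rw [ha i hi, and_iff_right hi, hA]⟩
  intro y
  refine Num.induction (fun y => ∃ a, ∀ i, i < n → (code a b i ↔ i < y ∧ M.mem i A)) ?_ ?_ y
  -- The number 1 codes the empty set, because `b > 0` makes every modulus larger than 1.
  · refine ⟨1, fun i _ => iff_of_false ?_ fun h => absurd h.1 (Num.zero_le' i).not_gt⟩
    rintro ⟨w, hw⟩
    have hw0 : w ≠ 0 := by rintro rfl; simp at hw
    obtain ⟨w, rfl⟩ := Num.exists_eq_add_one hw0
    have : (1 : M.Num) < (1 + (i + 1) * b) * (w + 1) := by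
      obtain ⟨c, rfl⟩ := Num.exists_eq_add_one hb₀.ne'
      refine (Num.lt_iff_exists _ _).2 ⟨w + (i + i * c + c) * w + (i + i * c + c) + w, by ring⟩
    exact this.ne hw
  · rintro y ⟨a, ha⟩
    by_cases hy : y < n ∧ M.mem y A
    · refine ⟨a * (1 + (y + 1) * b), fun i hi => ?_⟩
      rcases eq_or_ne i y with rfl | hiy
      · exact iff_of_true (dvd_mul_left _ _) ⟨Num.lt_add_one_iff'.2 le_rfl, hy.2⟩
      · rw [Num.lt_add_one_iff', hiy.le_iff_lt, ← ha i hi]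
        exact ⟨code_of_code_mul hb hi hy.1 hiy, fun h => h.mul_right _⟩
    · refine ⟨a, fun i hi => (ha i hi).trans ?_⟩
      rw [Num.lt_add_one_iff']
      refine and_congr_left fun h => ⟨le_of_lt, fun h' => lt_of_le_of_ne h' ?_⟩
      rintro rfl
      exact hy ⟨hi, h⟩

/-! ### Functions into finite sets -/

variable {S T : Type*}

/-- A function into a finite set whose fibres belong to the model. -/
class Coded (f : M.Num → S) : Prop where
  out : ∀ s, ∃ A : M.Sets, ∀ x, M.mem x A ↔ f x = s

/-- A binary function into a finite set whose fibres belong to the model. -/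
class Coded₂ (f : M.Num → M.Num → S) : Prop where
  out : ∀ s, ∃ A : M.Sets, ∀ x y, M.mem (pair x y) A ↔ f x y = s

instance FinBdd.coded (f : M.Num → S) (t : (Fin n → M.Num) → M.Num) [hf : Coded f] [IsTm t] :
    FinBdd (fun v => f (t v)) := by
  refine ⟨fun s => ?_⟩
  obtain ⟨A, hA⟩ := hf.out s
  simp only [← hA]
  infer_instance

instance FinBdd.coded₂ (f : M.Num → M.Num → S) (t t' : (Fin n → M.Num) → M.Num) [hf : Coded₂ f]
    [IsTm t] [IsTm t'] : FinBdd (fun v => f (t v) (t' v)) := by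
  refine ⟨fun s => ?_⟩
  obtain ⟨A, hA⟩ := hf.out s
  simp only [← hA]
  infer_instance

theorem coded_of_finBdd {f : M.Num → S} (h : FinBdd fun v : Fin 1 → M.Num => f (v 0)) :
    Coded f :=
  ⟨fun s => comprehension_of_bdd fun x => f x = s⟩

/-- Numbers that are not pairs have to go into the complement, which stays Σ⁰₁ because the
components of a pair are bounded by it. The three variables are y, x and the coded pair, in the
order in which instance search meets them below two quantifiers. -/
theorem comprehension₂ (P R : M.Num → M.Num → Prop)
    [Sig fun w : Fin 3 → M.Num => P (w (Fin.succ 0)) (w 0)]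
    [Sig fun w : Fin 3 → M.Num => R (w (Fin.succ 0)) (w 0)] (hPR : ∀ x y, P x y ↔ ¬ R x y) :
    ∃ A : M.Sets, ∀ x y, M.mem (pair x y) A ↔ P x y := by
  have key : ∀ p, (∃ x y, p = pair x y ∧ P x y) ↔
      ¬ ((∀ x, x < p + 1 → ∀ y, y < p + 1 → p ≠ pair x y) ∨ ∃ x y, p = pair x y ∧ R x y) := by
    intro p
    constructor
    · rintro ⟨x, y, rfl, h⟩ (h' | ⟨x', y', h', hR⟩)
      · exact h' x (Num.lt_add_one_iff'.2 (le_pair_left x y)) y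
          (Num.lt_add_one_iff'.2 (le_pair_right x y)) rfl
      · rw [pair_inj] at h'
        rw [← h'.1, ← h'.2] at hR
        exact (hPR x y).1 h hR
    · intro h
      rw [not_or] at h
      push Not at h
      obtain ⟨⟨x, -, y, -, hp⟩, h⟩ := h
      exact ⟨x, y, hp, (hPR x y).2 (h x y hp)⟩
  obtain ⟨A, hA⟩ := comprehension (fun p => ∃ x y, p = pair x y ∧ P x y)
    (fun p => (∀ x, x < p + 1 → ∀ y, y < p + 1 → p ≠ pair x y) ∨ ∃ x y, p = pair x y ∧ R x y) key
  refine ⟨A, fun x y => (hA _).trans ⟨?_, fun h => ⟨x, y, rfl, h⟩⟩⟩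
  rintro ⟨x', y', h, hP⟩
  rw [pair_inj] at h
  rwa [h.1, h.2]

/-- The complement of a fibre is the union of the finitely many other fibres, so Σ⁰₁ fibres are
already Δ⁰₁. -/
theorem coded_of_sig [Finite S] {f : M.Num → S}
    (h : ∀ s, Sig fun v : Fin 1 → M.Num => f (v 0) = s) : Coded f := by
  refine ⟨fun s => comprehension (fun x => f x = s) (fun x => ∃ t, t ≠ s ∧ f x = t) fun x => ?_⟩
  simp

theorem coded₂_of_sig [Finite S] {f : M.Num → M.Num → S}
    (h : ∀ s, Sig fun w : Fin 3 → M.Num => f (w (Fin.succ 0)) (w 0) = s) : Coded₂ f := by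
  refine ⟨fun s => comprehension₂ (fun x y => f x y = s) (fun x y => ∃ t, t ≠ s ∧ f x y = t)
    fun x y => ?_⟩
  simp

theorem coded_induction [Finite S] (f : M.Num → S) [Coded f] (U : S → Prop) (zero : U (f 0))
    (succ : ∀ x, U (f x) → U (f (x + 1))) (x : M.Num) : U (f x) :=
  have : Bdd fun v : Fin 1 → M.Num => U (f (v 0)) := .pred U _
  Num.induction (fun x => U (f x)) zero succ x

/-! ### Recursion -/

section Recursion

variable [Finite S] (G : M.Num → M.Num → S → S) (s₀ : S)

/-- Numbers that name the elements of a finite set in a model. -/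
noncomputable def index (s : S) : M.Num := ((Finite.equivFin S s : ℕ) : M.Num)

theorem index_inj {s t : S} : (index s : M.Num) = index t ↔ s = t := by
  unfold index
  rw [Nat.cast_inj, Fin.val_inj, EmbeddingLike.apply_eq_iff_eq]

theorem index_le (s : S) : (index s : M.Num) ≤ (Nat.card S : M.Num) := by
  unfold index
  exact Nat.cast_le.2 (Finite.equivFin S s).2.le

/-- The set coded by `a` and `b` contains the values up to `x` of the function that is defined by
recursion from `s₀` and `G y`. -/
def IsComp (a b y x : M.Num) : Prop :=
  (∀ s : S, code a b (pair 0 (index s)) ↔ s = s₀) ∧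
    ∀ i, i < x → ∀ s s' : S, code a b (pair i (index s)) →
      (code a b (pair (i + 1) (index s')) ↔ G y i s = s')

variable {G s₀}

instance [hG : Coded₂ G] (f g h k : (Fin n → M.Num) → M.Num) [IsTm f] [IsTm g] [IsTm h] [IsTm k] :
    Bdd (fun v => IsComp G s₀ (f v) (g v) (h v) (k v)) := by
  unfold IsComp
  have (s s' : S) (t t' : (Fin (n + 1) → M.Num) → M.Num) [IsTm t] [IsTm t'] :
      Bdd (fun v => G (t v) (t' v) s = s') := .pred (fun F : S → S => F s = s') _
  infer_instance

theorem IsComp.mono {a b y x x' : M.Num} (h : IsComp G s₀ a b y x) (hx : x' ≤ x) :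
    IsComp G s₀ a b y x' :=
  ⟨h.1, fun i hi => h.2 i (hi.trans_le hx)⟩

/-- Two computations with the same data agree as far as both reach, by induction on a bounded
formula. Hence a value may be defined through any computation that is long enough. -/
theorem IsComp.exists_unique {a b a' b' y x x' : M.Num} (h : IsComp G s₀ a b y x)
    (h' : IsComp G s₀ a' b' y x') (i : M.Num) : i ≤ x → i ≤ x' →
      ∃ s : S, (∀ t, code a b (pair i (index t)) ↔ t = s) ∧
        ∀ t, code a' b' (pair i (index t)) ↔ t = s := by
  refine Num.induction (fun i => i ≤ x → i ≤ x' →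
    ∃ s : S, (∀ t, code a b (pair i (index t)) ↔ t = s) ∧
      ∀ t, code a' b' (pair i (index t)) ↔ t = s) (fun _ _ => ⟨s₀, h.1, h'.1⟩)
    (fun i ih hi hi' => ?_) i
  have hx := lt_of_lt_of_le (Num.lt_add_one_iff'.2 le_rfl) hi
  have hx' := lt_of_lt_of_le (Num.lt_add_one_iff'.2 le_rfl) hi'
  obtain ⟨s, h₁, h₂⟩ := ih hx.le hx'.le
  refine ⟨G y i s, fun t => ?_, fun t => ?_⟩
  · rw [h.2 i hx s t ((h₁ s).2 rfl), eq_comm]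
  · rw [h'.2 i hx' s t ((h₂ s).2 rfl), eq_comm]

theorem exists_isComp [Coded₂ G] (s₀ : S) (y x : M.Num) : ∃ a b, IsComp G s₀ a b y x := by
  refine Num.induction (fun x => ∃ a b, IsComp G s₀ a b y x) ?_ ?_ x
  · obtain ⟨a, b, h⟩ := exists_code (fun p => p = pair 0 (index s₀))
      (pair 0 (Nat.card S : M.Num) + 1)
    refine ⟨a, b, fun s => ?_, fun i hi => absurd hi (Num.zero_le' i).not_gt⟩
    rw [h _ (Num.lt_add_one_iff'.2 (pair_mono le_rfl (index_le s))), pair_inj, index_inj]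
    simp
  · rintro x ⟨a, b, h⟩
    obtain ⟨s, hs, -⟩ := h.exists_unique h x le_rfl le_rfl
    -- The modulus parameter depends on the length, so the code is not extended but made anew: the
    -- old values up to `x` are copied and the value at `x + 1` is added.
    obtain ⟨a', b', h'⟩ := exists_code (fun p =>
        (∃ i, i < x + 1 ∧ ∃ t : S, p = pair i (index t) ∧ code a b p) ∨
          p = pair (x + 1) (index (G y x s)))
      (pair (x + 1) (Nat.card S : M.Num) + 1)
    have h₁ : ∀ i, i ≤ x → ∀ t : S,
        (code a' b' (pair i (index t)) ↔ code a b (pair i (index t))) := by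
      intro i hi t
      rw [h' _ (Num.lt_add_one_iff'.2 (pair_mono (hi.trans le_self_add) (index_le t)))]
      constructor
      · rintro (⟨_, -, _, -, h⟩ | h)
        · exact h
        · rw [pair_inj] at h
          exact absurd h.1 (Num.lt_add_one_iff'.2 hi).ne
      · exact fun h => .inl ⟨i, Num.lt_add_one_iff'.2 hi, t, rfl, h⟩
    have h₂ : ∀ t : S, code a' b' (pair (x + 1) (index t)) ↔ G y x s = t := by
      intro t
      rw [h' _ (Num.lt_add_one_iff'.2 (pair_mono le_rfl (index_le t)))]
      constructor
      · rintro (⟨i, hi, t', h, -⟩ | h)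
        · rw [pair_inj] at h
          exact absurd h.1.symm hi.ne
        · rw [pair_inj, index_inj] at h
          exact h.2.symm
      · rintro rfl
        exact .inr rfl
    refine ⟨a', b', fun t => (h₁ 0 (Num.zero_le' _) t).trans (h.1 t), fun i hi t t' ht => ?_⟩
    have hi' := Num.lt_add_one_iff'.1 hi
    rw [h₁ i hi'] at ht
    rcases hi'.lt_or_eq with hix | rfl
    · rw [h₁ (i + 1) ?_]
      · exact h.2 i hix t t' ht
      · obtain ⟨z, rfl⟩ := (Num.lt_iff_exists _ _).1 hix
        exact ⟨z, by ring⟩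
    · rw [hs] at ht
      rw [h₂, ht]

/-- That some computation yields `s` at `x` is Σ⁰₁, and computations agree, so this defines a
function; finiteness of `S` then puts its fibres into the model. -/
theorem exists_rec₂ [Coded₂ G] (s₀ : S) : ∃ f : M.Num → M.Num → S, Coded₂ f ∧ (∀ y, f y 0 = s₀) ∧
    ∀ y x, f y (x + 1) = G y x (f y x) := by
  have h : ∀ y x, ∃ s : S, ∃ a b, IsComp G s₀ a b y x ∧ code a b (pair x (index s)) := by
    intro y x
    obtain ⟨a, b, h⟩ := exists_isComp (G := G) s₀ y x
    obtain ⟨s, hs, -⟩ := h.exists_unique h x le_rfl le_rfl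
    exact ⟨s, a, b, h, (hs s).2 rfl⟩
  choose f hf using h
  have hf' : ∀ y x s,
      f y x = s ↔ ∃ a b, IsComp G s₀ a b y x ∧ code a b (pair x (index s)) := by
    intro y x s
    refine ⟨by rintro rfl; exact hf y x, ?_⟩
    rintro ⟨a, b, h, hs⟩
    obtain ⟨a', b', h', hs'⟩ := hf y x
    obtain ⟨t, h₁, h₂⟩ := h.exists_unique h' x le_rfl le_rfl
    rw [h₁] at hs
    rw [h₂] at hs'
    rw [hs, hs']
  refine ⟨f, coded₂_of_sig fun s => ?_, fun y => ?_, fun y x => ?_⟩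
  · simp only [hf']
    infer_instance
  · obtain ⟨a, b, h, hs⟩ := hf y 0
    exact (h.1 _).1 hs
  · obtain ⟨a, b, h, hs⟩ := hf y (x + 1)
    obtain ⟨t, h₁, -⟩ := h.exists_unique h x le_self_add le_self_add
    have hx : x < x + 1 := Num.lt_add_one_iff'.2 le_rfl
    have ht := (h₁ t).2 rfl
    have : f y x = t := (hf' y x t).2 ⟨a, b, h.mono hx.le, ht⟩
    rw [this, (h.2 x hx t _ ht).1 hs]

theorem exists_rec (G : M.Num → S → S) [Coded G] (s₀ : S) : ∃ f : M.Num → S, Coded f ∧ f 0 = s₀ ∧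
    ∀ x, f (x + 1) = G x (f x) := by
  have : Coded₂ fun _ : M.Num => G := ⟨fun s => comprehension₂ _ (fun _ x => G x ≠ s)
    fun _ _ => not_not.symm⟩
  obtain ⟨f, hf, h₀, h⟩ := exists_rec₂ (G := fun _ : M.Num => G) s₀
  exact ⟨f 0, coded_of_finBdd inferInstance, h₀ 0, h 0⟩

end Recursion

end Coding

end SOArith

namespace SOArith

/-! ### Sequences over a finite set in a model -/

section Sequences

variable {M : Str.{u}}

theorem Fm.realize_disj {n m : ℕ} (l : List (Fm n m)) (ρ : Fin n → M.Num) (η : Fin m → M.Sets) :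
    (Fm.disj l).Realize M ρ η ↔ ∃ φ ∈ l, φ.Realize M ρ η := by
  induction l with
  | nil => simp [Fm.disj, Fm.Realize]
  | cons φ l ih => simp [Fm.disj, Fm.Realize, ih]

theorem Tm.eval_pair {n : ℕ} (s t : Tm n) (ρ : Fin n → M.Num) :
    (s.pair t).eval M ρ = SOArith.pair (s.eval M ρ) (t.eval M ρ) := rfl

variable [hM : IsModel M]

theorem Tm.eval_num {n : ℕ} (k : ℕ) (ρ : Fin n → M.Num) :
    (Tm.num k : Tm n).eval M ρ = (k : M.Num) := by
  induction k with
  | zero => exact Nat.cast_zero.symm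
  | succ k ih => rw [Tm.num, Tm.eval, ih, Num.succ_eq_add_one, Nat.cast_succ]

variable {α : Type*}

theorem Fm.realize_inFin [Finite α] (c : α → ℕ) (S : Set α) {n m : ℕ} (t : Tm n)
    (ρ : Fin n → M.Num) (η : Fin m → M.Sets) :
    (Fm.inFin c S t).Realize M ρ η ↔ ∃ s ∈ S, t.eval M ρ = (c s : M.Num) := by
  simp [Fm.inFin, Fm.realize_disj, Fm.Realize, Tm.eval_num]

/-- The set `A` is the graph of `f`, where the values of `f` are coded by `c`. -/
def Represents (c : α → ℕ) (A : M.Sets) (f : M.Num → α) : Prop :=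
  ∀ x y, M.mem (pair x y) A ↔ y = (c (f x) : M.Num)

theorem Fm.realize_isSeq [Finite α] (c : α → ℕ) {n m : ℕ} (X : Fin m)
    (ρ : Fin n → M.Num) (η : Fin m → M.Sets) :
    (Fm.isSeq c X).Realize M ρ η ↔ ∃ f, Represents c (η X) f := by
  simp only [Fm.isSeq, Fm.Realize, Fm.realize_inFin, Fm.app, Fm.imp, ← imp_iff_not_or,
    Tm.eval_pair, Tm.eval]
  constructor
  · rintro ⟨h₁, h₂⟩
    have h₁' : ∀ x, ∃ s, M.mem (SOArith.pair x (c s : M.Num)) (η X) := by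
      intro x
      obtain ⟨_, ⟨s, -, rfl⟩, h⟩ := h₁ x
      exact ⟨s, h⟩
    choose f hf using h₁'
    exact ⟨f, fun x y => ⟨fun h => h₂ x _ _ ⟨h, hf x⟩, fun h => h ▸ hf x⟩⟩
  · rintro ⟨f, hf⟩
    refine ⟨fun x => ⟨_, ⟨f x, Set.mem_univ _, rfl⟩, (hf x _).2 rfl⟩, fun x y z h => ?_⟩
    exact ((hf x y).1 h.1).trans ((hf x z).1 h.2).symm

theorem Represents.coded {c : α → ℕ} (hc : c.Injective) {A : M.Sets} {f : M.Num → α}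
    (h : Represents c A f) : Coded f := by
  refine coded_of_finBdd ⟨fun s => ?_⟩
  have : ∀ x, f x = s ↔ M.mem (pair x (c s : M.Num)) A := fun x => by
    rw [h, Nat.cast_inj, hc.eq_iff, eq_comm]
  simp only [this]
  infer_instance

theorem Coded.exists_represents [Finite α] (c : α → ℕ) (f : M.Num → α) [Coded f] :
    ∃ A : M.Sets, Represents c A f := by
  obtain ⟨A, hA⟩ := comprehension₂ (M := M) (fun x y => ∃ s, f x = s ∧ y = (c s : M.Num))
    (fun x y => ¬ ∃ s, f x = s ∧ y = (c s : M.Num)) fun _ _ => not_not.symm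
  exact ⟨A, fun x y => by simp [hA]⟩

end Sequences

end SOArith

/-! ### Acceptance of a word in a model -/

namespace NBA

open SOArith

variable {M : Str.{u}} {A Q : Type*}

/-- `r` is an accepting run of the automaton on the word `w`. -/
structure IsAccRun (𝒜 : NBA A Q) (w : M.Num → A) (r : M.Num → Q) : Prop where
  zero : r 0 = 𝒜.q₀
  step : ∀ x, ((r x, w x), r (x + 1)) ∈ 𝒜.δ
  frequently : ∀ x, ∃ y, x < y ∧ r y ∈ 𝒜.F

variable [hM : IsModel M] [Finite A] [Finite Q]

theorem realize_inδ (𝒜 : NBA A Q) (cA : A → ℕ) (cQ : Q → ℕ) {n m : ℕ} (p a q : Tm n)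
    (ρ : Fin n → M.Num) (η : Fin m → M.Sets) :
    (𝒜.inδ cA cQ p a q).Realize M ρ η ↔ ∃ e ∈ 𝒜.δ, p.eval M ρ = (cQ e.1.1 : M.Num) ∧
      a.eval M ρ = (cA e.1.2 : M.Num) ∧ q.eval M ρ = (cQ e.2 : M.Num) := by
  simp [inδ, Fm.realize_disj, Fm.Realize, Tm.eval_num]

/-- Replaces the formula by coded runs, after which no syntax is needed. Injectivity of the codings,
and of the map from naturals to numbers of the model, recovers letters and states from their
numerals. -/
theorem realize_inLang (𝒜 : NBA A Q) {cA : A → ℕ} (hA : cA.Injective) {cQ : Q → ℕ}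
    (hQ : cQ.Injective) {n m : ℕ} (X : Fin m) (ρ : Fin n → M.Num) (η : Fin m → M.Sets)
    {w : M.Num → A} (hw : Represents cA (η X) w) :
    (𝒜.inLang cA cQ X).Realize M ρ η ↔ ∃ r : M.Num → Q, Coded r ∧ 𝒜.IsAccRun w r := by
  simp only [inLang, Fm.Realize, Fm.realize_isSeq, Fm.realize_inFin, realize_inδ, Fm.app,
    Tm.eval_pair, Tm.eval, Tm.eval_num]
  rw [and_iff_right ⟨w, hw⟩]
  constructor
  · rintro ⟨Y, ⟨r, hr⟩, h₀, h₁, h₂⟩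
    refine ⟨r, hr.coded hQ, ?_, fun x => ?_, fun x => ?_⟩
    · have := (hr _ _).1 h₀
      exact (hQ (Nat.cast_injective this)).symm
    · obtain ⟨p, a, q, hp, ha, hq, ⟨⟨p', a'⟩, q'⟩, he, h₁, h₂, h₃⟩ := h₁ x
      have e₁ := ((hr _ _).1 hp).symm.trans h₁
      have e₂ := ((hw _ _).1 ha).symm.trans h₂
      have e₃ := ((hr _ _).1 hq).symm.trans h₃
      have e₁' : r x = p' := hQ (Nat.cast_injective e₁)
      have e₂' : w x = a' := hA (Nat.cast_injective e₂)
      have e₃' : r (M.succ x) = q' := hQ (Nat.cast_injective e₃)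
      rw [← Num.succ_eq_add_one, e₁', e₂', e₃']
      exact he
    · obtain ⟨y, hy, z, hz, q, hq, h⟩ := h₂ x
      refine ⟨y, hy, ?_⟩
      have e : r y = q := hQ (Nat.cast_injective (((hr _ _).1 hz).symm.trans h))
      rwa [e]
  · rintro ⟨r, hr, h⟩
    obtain ⟨Y, hY⟩ := Coded.exists_represents cQ r
    refine ⟨Y, ⟨r, hY⟩, (hY _ _).2 ?_, fun x => ?_, fun x => ?_⟩
    · exact congrArg (fun q => (cQ q : M.Num)) h.zero.symm
    · refine ⟨_, _, _, (hY x _).2 rfl, (hw x _).2 rfl, (hY (M.succ x) _).2 rfl,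
        ((r x, w x), r (M.succ x)), ?_, rfl, rfl, rfl⟩
      rw [Num.succ_eq_add_one]
      exact h.step x
    · obtain ⟨y, hy, h⟩ := h.frequently x
      exact ⟨y, hy, _, (hY y _).2 rfl, _, h, rfl⟩

end NBA

namespace NBA

/-! ### The monoid of transition matrices -/

section Matrices

variable {A Q : Type*} (𝒜 : NBA A Q)

theorem transMatrix_pos {σ : List A} {q q' : Q} :
    0 < 𝒜.transMatrix σ q q' ↔ ∃ x, 𝒜.IsPath σ q q' x := by
  unfold transMatrix
  split_ifs with h h'
  · simp only [ENat.top_pos, true_iff]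
    obtain ⟨x, hx, -⟩ := h
    exact ⟨x, hx⟩
  · simpa using h'
  · simpa using h'

theorem transMatrix_eq_top {σ : List A} {q q' : Q} :
    𝒜.transMatrix σ q q' = ⊤ ↔ ∃ x, 𝒜.IsPath σ q q' x ∧ ∃ i, i ≠ 0 ∧ x i ∈ 𝒜.F := by
  unfold transMatrix
  split_ifs with h h' <;> simp [h]

theorem transMatrix_mem (σ : List A) (q q' : Q) :
    𝒜.transMatrix σ q q' ∈ ({0, 1, ⊤} : Set ℕ∞) := by
  unfold transMatrix
  split_ifs <;> simp

/-- Reduces identities between matrices to two questions: is there a path, and is there one that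
hits an accepting state. -/
theorem eq_of_pos_iff_of_eq_top_iff {a b : ℕ∞} (ha : a ∈ ({0, 1, ⊤} : Set ℕ∞))
    (hb : b ∈ ({0, 1, ⊤} : Set ℕ∞)) (h : 0 < a ↔ 0 < b) (h' : a = ⊤ ↔ b = ⊤) : a = b := by
  rcases ha with rfl | rfl | rfl <;> rcases hb with rfl | rfl | rfl <;> simp_all

theorem isPath_cons {a : A} {σ : List A} {q q' : Q} {x : Fin ((a :: σ).length + 1) → Q} :
    𝒜.IsPath (a :: σ) q q' x ↔
      x 0 = q ∧ ((q, a), x 1) ∈ 𝒜.δ ∧ 𝒜.IsPath σ (x 1) q' (fun i => x i.succ) := by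
  unfold IsPath
  constructor
  · rintro ⟨rfl, h, h'⟩
    exact ⟨rfl, h' 0, rfl, h, fun i => h' i.succ⟩
  · rintro ⟨rfl, h, -, h', h''⟩
    refine ⟨rfl, h', fun i => ?_⟩
    exact Fin.cases (motive := fun i : Fin (σ.length + 1) =>
      ((x i.castSucc, (a :: σ).get i), x i.succ) ∈ 𝒜.δ) h h'' i

theorem exists_isPath_cons {a : A} {σ : List A} {q q' : Q} :
    (∃ x, 𝒜.IsPath (a :: σ) q q' x) ↔ ∃ p, ((q, a), p) ∈ 𝒜.δ ∧ ∃ x, 𝒜.IsPath σ p q' x := by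
  constructor
  · rintro ⟨x, hx⟩
    obtain ⟨-, h, h'⟩ := (𝒜.isPath_cons).1 hx
    exact ⟨_, h, _, h'⟩
  · rintro ⟨p, h, x, hx⟩
    have h₀ := hx.1
    refine ⟨Fin.cons q x, (𝒜.isPath_cons).2 ⟨rfl, ?_, ?_⟩⟩
    · change ((q, a), x 0) ∈ 𝒜.δ
      rwa [h₀]
    · change 𝒜.IsPath σ (x 0) q' x
      rwa [h₀]

/-- The first state `p` after `a` counts for the long word but is the starting point, hence ignored,
for the rest; this is why it gets its own case. -/
theorem exists_isPath_hit_cons {a : A} {σ : List A} {q q' : Q} :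
    (∃ x, 𝒜.IsPath (a :: σ) q q' x ∧ ∃ i, i ≠ 0 ∧ x i ∈ 𝒜.F) ↔
      ∃ p, ((q, a), p) ∈ 𝒜.δ ∧ ((p ∈ 𝒜.F ∧ ∃ x, 𝒜.IsPath σ p q' x) ∨
        ∃ x, 𝒜.IsPath σ p q' x ∧ ∃ i, i ≠ 0 ∧ x i ∈ 𝒜.F) := by
  constructor
  · rintro ⟨x, hx, i, hi, hF⟩
    obtain ⟨-, h, h'⟩ := (𝒜.isPath_cons).1 hx
    refine ⟨_, h, ?_⟩
    obtain ⟨j, rfl⟩ := Fin.exists_succ_eq.2 hi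
    rcases eq_or_ne j 0 with rfl | hj
    · exact .inl ⟨hF, _, h'⟩
    · exact .inr ⟨_, h', j, hj, hF⟩
  · rintro ⟨p, h, h'⟩
    have key : ∀ x, 𝒜.IsPath σ p q' x → 𝒜.IsPath (a :: σ) q q' (Fin.cons q x) := by
      intro x hx
      have h₀ := hx.1
      refine (𝒜.isPath_cons).2 ⟨rfl, ?_, ?_⟩
      · change ((q, a), x 0) ∈ 𝒜.δ
        rwa [h₀]
      · change 𝒜.IsPath σ (x 0) q' x
        rwa [h₀]
    rcases h' with ⟨hp, x, hx⟩ | ⟨x, hx, i, -, hF⟩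
    · refine ⟨_, key x hx, Fin.succ 0, Fin.succ_ne_zero _, ?_⟩
      change x 0 ∈ 𝒜.F
      rwa [hx.1]
    · exact ⟨_, key x hx, i.succ, Fin.succ_ne_zero _, hF⟩

theorem transMatrix_nil (q q' : Q) [Decidable (q = q')] :
    𝒜.transMatrix [] q q' = if q = q' then 1 else 0 := by
  have h : ¬ ∃ x, 𝒜.IsPath [] q q' x ∧ ∃ i, i ≠ 0 ∧ x i ∈ 𝒜.F := by
    rintro ⟨x, -, i, hi, -⟩
    exact hi (Subsingleton.elim (α := Fin 1) _ _)
  have h' : (∃ x, 𝒜.IsPath [] q q' x) ↔ q = q' := by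
    constructor
    · rintro ⟨x, rfl, h, -⟩
      exact h
    · rintro rfl
      exact ⟨fun _ => q, rfl, rfl, fun i => i.elim0⟩
  unfold transMatrix
  rw [if_neg h]
  split_ifs <;> simp_all

theorem transMatrix_singleton_pos {a : A} {q q' : Q} :
    0 < 𝒜.transMatrix [a] q q' ↔ ((q, a), q') ∈ 𝒜.δ := by
  classical
  rw [transMatrix_pos, exists_isPath_cons]
  simp only [← transMatrix_pos, transMatrix_nil]
  constructor
  · rintro ⟨p, h, h'⟩
    split_ifs at h' with hp
    · exact hp ▸ h
    · simp at h'
  · exact fun h => ⟨q', h, by simp⟩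

theorem transMatrix_singleton_eq_top {a : A} {q q' : Q} :
    𝒜.transMatrix [a] q q' = ⊤ ↔ ((q, a), q') ∈ 𝒜.δ ∧ q' ∈ 𝒜.F := by
  classical
  rw [transMatrix_eq_top, exists_isPath_hit_cons]
  simp only [← transMatrix_pos, ← transMatrix_eq_top, transMatrix_nil]
  constructor
  · rintro ⟨p, h, ⟨hF, h'⟩ | h'⟩
    · split_ifs at h' with hp
      · exact hp ▸ ⟨h, hF⟩
      · simp at h'
    · split_ifs at h' <;> simp at h'
  · exact fun h => ⟨q', h.1, .inl ⟨h.2, by simp⟩⟩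

theorem comp_pos {β γ : Q → Q → ℕ∞} {q q' : Q} :
    0 < comp β γ q q' ↔ ∃ p, 0 < β q p ∧ 0 < γ p q' := by
  unfold comp
  simp only [lt_iSup_iff, pos_iff_ne_zero, mul_ne_zero_iff]

/-- Finiteness of `Q` makes the supremum attained; in general finite entries could have supremum ∞.
-/
theorem comp_eq_top [Finite Q] {β γ : Q → Q → ℕ∞} {q q' : Q} :
    comp β γ q q' = ⊤ ↔
      ∃ p, (β q p = ⊤ ∧ 0 < γ p q') ∨ (0 < β q p ∧ γ p q' = ⊤) := by
  have h : comp β γ q q' = ⊤ ↔ ∃ p, β q p * γ p q' = ⊤ := by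
    unfold comp
    constructor
    · intro h
      have : Nonempty Q := ⟨q⟩
      obtain ⟨p, hp⟩ := exists_eq_ciSup_of_finite (f := fun p => β q p * γ p q')
      exact ⟨p, hp.trans h⟩
    · rintro ⟨p, hp⟩
      exact top_unique (hp ▸ le_iSup (fun p => β q p * γ p q') p)
  rw [h]
  refine exists_congr fun p => ?_
  rw [pos_iff_ne_zero, pos_iff_ne_zero]
  refine (WithTop.mul_eq_top_iff (α := ℕ)).trans ?_
  exact or_comm.trans (or_congr Iff.rfl Iff.rfl)

theorem comp_assoc (β γ ζ : Q → Q → ℕ∞) : comp (comp β γ) ζ = comp β (comp γ ζ) := by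
  funext q q'
  simp only [comp, ENat.iSup_mul, ENat.mul_iSup, mul_assoc]
  exact iSup_comm

theorem nil_comp (β : Q → Q → ℕ∞) : comp (𝒜.transMatrix []) β = β := by
  classical
  funext q q'
  simp only [comp, transMatrix_nil]
  refine le_antisymm (iSup_le fun p => ?_) ((le_of_eq ?_).trans (le_iSup _ q))
  · split_ifs with h
    · rw [h, one_mul]
    · simp
  · simp

theorem comp_nil (β : Q → Q → ℕ∞) : comp β (𝒜.transMatrix []) = β := by
  classical
  funext q q'
  simp only [comp, transMatrix_nil]
  refine le_antisymm (iSup_le fun p => ?_) ((le_of_eq ?_).trans (le_iSup _ q'))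
  · split_ifs with h
    · rw [h, mul_one]
    · simp
  · simp

noncomputable instance : One 𝒜.Mat := ⟨𝒜.transMatrix [], [], rfl⟩

/-- The transition matrix of a letter. -/
noncomputable def letter (a : A) : 𝒜.Mat := ⟨𝒜.transMatrix [a], [a], rfl⟩

section

variable {𝒜}

theorem letter_pos {a : A} {q q' : Q} : 0 < (𝒜.letter a).1 q q' ↔ ((q, a), q') ∈ 𝒜.δ :=
  𝒜.transMatrix_singleton_pos

theorem letter_eq_top {a : A} {q q' : Q} :
    (𝒜.letter a).1 q q' = ⊤ ↔ ((q, a), q') ∈ 𝒜.δ ∧ q' ∈ 𝒜.F :=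
  𝒜.transMatrix_singleton_eq_top

theorem Mat.one_pos {q q' : Q} : 0 < (1 : 𝒜.Mat).1 q q' ↔ q = q' := by
  classical
  change 0 < 𝒜.transMatrix [] q q' ↔ _
  rw [transMatrix_nil]
  split_ifs <;> simp_all

theorem Mat.one_ne_top {q q' : Q} : (1 : 𝒜.Mat).1 q q' ≠ ⊤ := by
  classical
  change 𝒜.transMatrix [] q q' ≠ _
  rw [transMatrix_nil]
  split_ifs <;> simp_all

end

variable [Finite Q]

theorem comp_mem {β γ : Q → Q → ℕ∞} (hβ : ∀ q q', β q q' ∈ ({0, 1, ⊤} : Set ℕ∞))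
    (hγ : ∀ q q', γ q q' ∈ ({0, 1, ⊤} : Set ℕ∞)) (q q' : Q) :
    comp β γ q q' ∈ ({0, 1, ⊤} : Set ℕ∞) := by
  have : Nonempty Q := ⟨q⟩
  obtain ⟨p, hp⟩ := exists_eq_ciSup_of_finite (f := fun p => β q p * γ p q')
  change (⨆ p, β q p * γ p q') ∈ _
  rw [← hp]
  rcases hβ q p with h | h | h <;> rcases hγ p q' with h' | h' | h' <;>
    simp only [h, Set.mem_singleton_iff.1 h, h', Set.mem_singleton_iff.1 h'] <;> simp

theorem transMatrix_cons (a : A) (σ : List A) :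
    𝒜.transMatrix (a :: σ) = comp (𝒜.transMatrix [a]) (𝒜.transMatrix σ) := by
  funext q q'
  refine eq_of_pos_iff_of_eq_top_iff (𝒜.transMatrix_mem _ _ _)
    (comp_mem (𝒜.transMatrix_mem _) (𝒜.transMatrix_mem _) _ _) ?_ ?_
  · rw [transMatrix_pos, exists_isPath_cons, comp_pos]
    simp only [transMatrix_singleton_pos, ← transMatrix_pos]
  · rw [transMatrix_eq_top, exists_isPath_hit_cons, comp_eq_top]
    simp only [transMatrix_singleton_pos, transMatrix_singleton_eq_top, ← transMatrix_pos,
      ← transMatrix_eq_top]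
    refine exists_congr fun p => ?_
    tauto

theorem transMatrix_append (σ τ : List A) :
    𝒜.transMatrix (σ ++ τ) = comp (𝒜.transMatrix σ) (𝒜.transMatrix τ) := by
  induction σ with
  | nil => rw [List.nil_append, nil_comp]
  | cons a σ ih => rw [List.cons_append, transMatrix_cons, ih, transMatrix_cons _ a σ, comp_assoc]

noncomputable instance : Monoid 𝒜.Mat where
  mul β γ := ⟨comp β.1 γ.1, by
    obtain ⟨_, σ, rfl⟩ := β
    obtain ⟨_, τ, rfl⟩ := γ
    exact ⟨σ ++ τ, 𝒜.transMatrix_append σ τ⟩⟩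
  mul_assoc β γ ζ := Subtype.ext (comp_assoc β.1 γ.1 ζ.1)
  one_mul β := Subtype.ext (𝒜.nil_comp β.1)
  mul_one β := Subtype.ext (𝒜.comp_nil β.1)

variable {𝒜}

theorem Mat.mul_pos {β γ : 𝒜.Mat} {q q' : Q} :
    0 < (β * γ).1 q q' ↔ ∃ p, 0 < β.1 q p ∧ 0 < γ.1 p q' := comp_pos

theorem Mat.mul_eq_top {β γ : 𝒜.Mat} {q q' : Q} : (β * γ).1 q q' = ⊤ ↔
    ∃ p, (β.1 q p = ⊤ ∧ 0 < γ.1 p q') ∨ (0 < β.1 q p ∧ γ.1 p q' = ⊤) := comp_eq_top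

theorem rejecting_iff {β γ : 𝒜.Mat} : 𝒜.Rejecting β.1 γ.1 ↔
    β * γ = β ∧ γ * γ = γ ∧ ∀ q, 0 < β.1 𝒜.q₀ q → γ.1 q q < ⊤ := by
  have h : ∀ β γ : 𝒜.Mat, β = γ ↔ β.1 = γ.1 := fun _ _ => Subtype.ext_iff
  rw [h, h]
  rfl

end Matrices

end NBA

namespace SOArith

/-! ### Products and Ramsey's theorem for additive colourings -/

section Ramsey

variable {M : Str.{u}} {T : Type*}

/-- The products from `x` and from `y` are eventually equal. -/
def Merge (c : M.Num → M.Num → T) (x y : M.Num) : Prop :=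
  ∃ z, (x ≤ z ∧ y ≤ z) ∧ c x z = c y z

theorem merge_symm {c : M.Num → M.Num → T} {x y : M.Num} (h : Merge c x y) : Merge c y x := by
  obtain ⟨z, ⟨hx, hy⟩, h⟩ := h
  exact ⟨z, ⟨hy, hx⟩, h.symm⟩

variable [hM : IsModel M]

/-- If every `s` failed beyond some bound, the largest of these finitely many bounds would refute
the hypothesis. `S` is finite in the metatheory, so no induction in the model is used and `P` may be
undefinable. -/
theorem exists_of_forall_exists_gt {S : Type*} [Finite S] (P : S → M.Num → Prop)
    (h : ∀ n, ∃ y, n < y ∧ ∃ s, P s y) : ∃ s, ∀ n, ∃ y, n < y ∧ P s y := by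
  cases nonempty_fintype S
  by_contra! h'
  choose f hf using h'
  obtain ⟨b, hb⟩ := Finset.exists_le (Finset.univ.image f)
  obtain ⟨y, hy, s, hs⟩ := h b
  exact hf s y ((hb _ (Finset.mem_image_of_mem f (Finset.mem_univ s))).trans_lt hy) hs

theorem Num.exists_eq_add_of_lt {x y : M.Num} (h : x < y) : ∃ d, y = x + d + 1 := by
  obtain ⟨d, rfl⟩ := (Num.lt_iff_exists _ _).1 h
  exact ⟨d, (add_assoc _ _ _).symm⟩

theorem Num.lt_add_one (x : M.Num) : x < x + 1 := Num.lt_add_one_iff'.2 le_rfl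

theorem Num.lt_add_add_one (x y : M.Num) : x < x + y + 1 := Num.lt_add_one_iff'.2 le_self_add

theorem Num.exists_least (P : M.Num → Prop) [Bdd fun v : Fin 1 → M.Num => P (v 0)]
    (h : ∃ x, P x) : ∃ x, P x ∧ ∀ y, y < x → ¬ P y := by
  obtain ⟨A, hA⟩ := comprehension_of_bdd P
  simp only [← hA] at h ⊢
  by_contra! h'
  have key : ∀ n y, y < n → ¬ M.mem y A := by
    intro n
    refine Num.induction (fun n => ∀ y, y < n → ¬ M.mem y A)
      (fun y hy => absurd hy (Num.zero_le' y).not_gt) (fun n ih y hy hA => ?_) n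
    rcases (Num.lt_add_one_iff'.1 hy).lt_or_eq with hy | rfl
    · exact ih y hy hA
    · obtain ⟨z, hz, hA⟩ := h' y hA
      exact ih z hz hA
  obtain ⟨x, hx⟩ := h
  exact key (x + 1) x (Num.lt_add_one x) hx

/-- Numbers that pairwise do not merge have different values c(x, b) at any common upper bound b, so
there are at most |T| of them. A set that cannot be enlarged is found by induction in the
metatheory. -/
theorem exists_transversal [Finite T] (c : M.Num → M.Num → T) :
    ∃ s : Finset M.Num, (∀ x ∈ s, ∀ y ∈ s, Merge c x y → x = y) ∧
      ∀ y, ∃ x ∈ s, Merge c x y := by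
  classical
  by_contra! hs
  have key : ∀ k : ℕ, ∃ s : Finset M.Num, (∀ x ∈ s, ∀ y ∈ s, Merge c x y → x = y) ∧
      s.card = k := by
    intro k
    induction k with
    | zero => exact ⟨∅, by simp, rfl⟩
    | succ k ih =>
      obtain ⟨s, h, hk⟩ := ih
      obtain ⟨y, hy⟩ := hs s h
      have hys : y ∉ s := fun h => hy y h ⟨y, ⟨le_rfl, le_rfl⟩, rfl⟩
      refine ⟨insert y s, ?_, by rw [Finset.card_insert_of_notMem hys, hk]⟩
      intro x hx z hz hxz
      rw [Finset.mem_insert] at hx hz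
      rcases hx with rfl | hx <;> rcases hz with rfl | hz
      · rfl
      · exact absurd (merge_symm hxz) (hy z hz)
      · exact absurd hxz (hy x hx)
      · exact h x hx z hz hxz
  obtain ⟨s, h, hk⟩ := key (Nat.card T + 1)
  obtain ⟨b, hb⟩ := Finset.exists_le s
  have hinj : Function.Injective fun x : s => c x b := fun x y hxy =>
    Subtype.ext (h x x.2 y y.2 ⟨b, ⟨hb x x.2, hb y y.2⟩, hxy⟩)
  have := Nat.card_le_card_of_injective _ hinj
  rw [Nat.card_eq_fintype_card, Fintype.card_coe, hk] at this
  exact this.not_gt (Nat.lt_succ_self _)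

variable [Monoid T]

/-- `c x y` is the product of the values of `u` in the interval `[x, y)`. -/
structure IsProd (u : M.Num → T) (c : M.Num → M.Num → T) : Prop where
  self : ∀ x, c x x = 1
  succ : ∀ x y, x ≤ y → c x (y + 1) = c x y * u y

/-- The factor that is appended to the product over `[x, y)`. -/
noncomputable def appendFactor (u : M.Num → T) (x y : M.Num) : T → T :=
  if y < x then fun _ => 1 else fun s => s * u y

/-- The recursion runs over the second argument from 0; it keeps the value 1 until `x` is reached
and multiplies from there on. -/
theorem exists_isProd [Finite T] (u : M.Num → T) [Coded u] :
    ∃ c, Coded₂ c ∧ IsProd u c := by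
  have : Coded₂ (appendFactor u) := by
    refine coded₂_of_sig fun s => ?_
    have (f g : (Fin 3 → M.Num) → M.Num) [IsTm f] [IsTm g] :
        FinBdd (fun v => appendFactor u (f v) (g v)) := by
      have := FinBdd.const (fun _ : T => (1 : T)) (M := M) (n := 3)
      have := FinBdd.map (fun t s : T => s * t) fun v => u (g v)
      unfold appendFactor
      infer_instance
    infer_instance
  obtain ⟨c, hc, h₀, h⟩ := exists_rec₂ (G := appendFactor u) 1
  refine ⟨c, hc, fun x => ?_, fun x y hxy => ?_⟩
  · rcases eq_or_ne x 0 with rfl | hx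
    · exact h₀ 0
    · obtain ⟨z, rfl⟩ := Num.exists_eq_add_one hx
      rw [h, appendFactor, if_pos (Num.lt_add_one z)]
  · rw [h, appendFactor, if_neg hxy.not_gt]

namespace IsProd

variable {u : M.Num → T} {c : M.Num → M.Num → T}

theorem self_succ (hc : IsProd u c) (x : M.Num) : c x (x + 1) = u x := by
  rw [hc.succ x x le_rfl, hc.self, one_mul]

variable [Finite T]

theorem mul [Coded₂ c] (hc : IsProd u c) {x y z : M.Num} (hxy : x ≤ y) (hyz : y ≤ z) :
    c x y * c y z = c x z := by
  obtain ⟨d, rfl⟩ := hyz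
  have : Coded fun d => (c x (y + d), c y (y + d)) := coded_of_finBdd inferInstance
  refine coded_induction (fun d => (c x (y + d), c y (y + d))) (fun p => c x y * p.2 = p.1) ?_ ?_ d
  · simp [hc.self]
  · intro d hd
    simp only [← add_assoc] at hd ⊢
    rw [hc.succ _ _ (hxy.trans le_self_add), hc.succ _ _ le_self_add, ← mul_assoc, hd]

theorem eq_of_le [Coded₂ c] (hc : IsProd u c) {x y z z' : M.Num} (hx : x ≤ z) (hy : y ≤ z)
    (h : c x z = c y z) (hz : z ≤ z') : c x z' = c y z' := by
  rw [← hc.mul hx hz, ← hc.mul hy hz, h]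

theorem merge_trans [Coded₂ c] (hc : IsProd u c) {x y z : M.Num} (h : Merge c x y)
    (h' : Merge c y z) : Merge c x z := by
  obtain ⟨a, ⟨hx, hy⟩, h⟩ := h
  obtain ⟨b, ⟨hy', hz⟩, h'⟩ := h'
  have ha : a ≤ max a b := le_max_left a b
  have hb : b ≤ max a b := le_max_right a b
  exact ⟨max a b, ⟨hx.trans ha, hz.trans hb⟩,
    (hc.eq_of_le hx hy h ha).trans (hc.eq_of_le hy' hz h' hb)⟩

/-- Merging is an equivalence relation with finitely many classes. Take an unbounded class,
represented by x₀, and a value γ that c(x₀, y) takes at unboundedly many y of it; let H consist of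
these y > x₀. For x in H, c(x, y) eventually equals c(x₀, y) = γ, and c(x₀, x)·c(x, y) = c(x₀, y)
yields γγ = γ. Only eventual homogeneity is claimed. -/
theorem exists_ramsey [Coded₂ c] (hc : IsProd u c) :
    ∃ (H : M.Num → Prop) (β γ : T), Coded H ∧ β * γ = β ∧ γ * γ = γ ∧
      (∀ y, H y → 0 < y ∧ c 0 y = β) ∧ (∀ n, ∃ y, n < y ∧ H y) ∧
      ∀ x, H x → ∃ n, ∀ y, n < y → H y → c x y = γ := by
  obtain ⟨s, hs, hs'⟩ := exists_transversal c
  obtain ⟨⟨x₀, hx₀⟩, hx₀'⟩ := exists_of_forall_exists_gt (fun (x : s) y => Merge c x y) fun n => by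
    obtain ⟨x, hx, h⟩ := hs' (n + 1)
    exact ⟨n + 1, Num.lt_add_one n, ⟨x, hx⟩, h⟩
  have hsig (x : M.Num) : Sig fun v : Fin 1 → M.Num => Merge c x (v 0) := by
    unfold Merge
    infer_instance
  -- Merging with x₀ is Σ⁰₁, and so is its negation: merging with one of the finitely many other
  -- representatives.
  obtain ⟨K, hK⟩ := comprehension (Merge c x₀)
      (fun y => ∃ x : s, x.1 ≠ x₀ ∧ Merge c x y) fun y => by
    constructor
    · rintro h ⟨x, hx, h'⟩
      exact hx (hs _ x.2 _ hx₀ (hc.merge_trans h' (merge_symm h)))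
    · intro h
      obtain ⟨x, hx, hxy⟩ := hs' y
      rcases eq_or_ne x x₀ with rfl | hne
      · exact hxy
      · exact absurd ⟨⟨x, hx⟩, hne, hxy⟩ h
  obtain ⟨γ, hγ⟩ := exists_of_forall_exists_gt
      (fun γ y => M.mem y K ∧ x₀ < y ∧ c x₀ y = γ) fun n => by
    obtain ⟨y, hy, h⟩ := hx₀' (max n x₀)
    rw [max_lt_iff] at hy
    exact ⟨y, hy.1, _, (hK y).2 h, hy.2, rfl⟩
  have hev : ∀ x, (M.mem x K ∧ x₀ < x ∧ c x₀ x = γ) → ∃ n, ∀ y, n < y →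
      (M.mem y K ∧ x₀ < y ∧ c x₀ y = γ) → c x y = γ := by
    rintro x ⟨hx, -, -⟩
    obtain ⟨z, ⟨hz, hz'⟩, h⟩ := (hK x).1 hx
    exact ⟨z, fun y hy hy' => (hc.eq_of_le hz hz' h hy.le).symm.trans hy'.2.2⟩
  have hγγ : γ * γ = γ := by
    obtain ⟨x, -, hx⟩ := hγ 0
    obtain ⟨n, hn⟩ := hev x hx
    obtain ⟨y, hy, hy'⟩ := hγ (max n x)
    rw [max_lt_iff] at hy
    have := hc.mul hx.2.1.le hy.2.le
    rwa [hx.2.2, hn y hy.1 hy', hy'.2.2] at this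
  refine ⟨fun y => M.mem y K ∧ x₀ < y ∧ c x₀ y = γ, c 0 x₀ * γ, γ, coded_of_finBdd ⟨fun p => ?_⟩,
    by rw [mul_assoc, hγγ], hγγ, fun y hy => ⟨(Num.zero_le' _).trans_lt hy.2.1, ?_⟩, hγ, hev⟩
  · simp only [eq_iff_iff]
    infer_instance
  · rw [← hc.mul (Num.zero_le' _) hy.2.1.le, hy.2.2]

end IsProd

end Ramsey

end SOArith

/-! ### Greedy steps of the complement automaton -/

namespace NBA

open SOArith

variable {A Q : Type*} [Finite Q] {𝒜 : NBA A Q}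

/-- The state in `{q₀} ∪ δ(A*)³ ∪ δ(A*) ∪ δ(A*)²` that follows `s` when the letter `a` is read,
where the end of a factor is accepted only if `h` holds. -/
noncomputable def greedyStep (β γ : 𝒜.Mat) (a : A) (h : Prop) : 𝒜.ComplState → 𝒜.ComplState
  | .init => .three β γ (𝒜.letter a)
  | .three β γ ζ =>
    open Classical in if h ∧ ζ * 𝒜.letter a = β then .one γ else .three β γ (ζ * 𝒜.letter a)
  | .one γ => open Classical in if h ∧ 𝒜.letter a = γ then .one γ else .two γ (𝒜.letter a)
  | .two γ ζ =>
    open Classical in if h ∧ ζ * 𝒜.letter a = γ then .one γ else .two γ (ζ * 𝒜.letter a)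

theorem complStep_greedyStep (β γ : 𝒜.Mat) (a : A) (h : Prop) {s : 𝒜.ComplState}
    (hs : s ≠ .init) : 𝒜.ComplStep s a (greedyStep β γ a h s) := by
  rcases s with _ | γ | ⟨γ, ζ⟩ | ⟨β, γ, ζ⟩
  · exact absurd rfl hs
  · simp only [greedyStep]
    split_ifs with h'
    · exact .oneDone _ _ (congrArg Subtype.val h'.2)
    · exact .oneStep _ _ _ rfl
  · simp only [greedyStep]
    split_ifs with h'
    · exact .twoDone _ _ _ (congrArg Subtype.val h'.2)
    · exact .twoStep _ _ _ _ rfl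
  · simp only [greedyStep]
    split_ifs with h'
    · exact .threeDone _ _ _ _ (congrArg Subtype.val h'.2)
    · exact .threeStep _ _ _ _ _ rfl

theorem greedyStep_ne_init (β γ : 𝒜.Mat) (a : A) (h : Prop) (s : 𝒜.ComplState) :
    greedyStep β γ a h s ≠ .init := by
  rcases s with _ | γ | ⟨γ, ζ⟩ | ⟨β, γ, ζ⟩ <;> simp only [greedyStep] <;> (try split_ifs) <;>
    simp

theorem of_greedyStep_eq_one {β γ γ' : 𝒜.Mat} {a : A} {h : Prop} {s : 𝒜.ComplState}
    (hs : greedyStep β γ a h s = .one γ') : h := by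
  rcases s with _ | γ | ⟨γ, ζ⟩ | ⟨β, γ, ζ⟩ <;> simp only [greedyStep] at hs
  · simp at hs
  all_goals
    split_ifs at hs with h'
    · exact h'.1

section Runs

variable {M : Str.{u}} [hM : IsModel M] {w : M.Num → A} {c : M.Num → M.Num → 𝒜.Mat}

/-! ### Factorisations given by runs of the complement automaton -/

section Factorisation

variable {Z : M.Num → 𝒜.ComplState} {β γ : 𝒜.Mat}

/-- Invariant for the product read since 0: it is the stored matrix during the first factor, β at an
accepting state, and β times the stored matrix later. The relation βγ = β absorbs all completed
factors. The index is shifted by one to skip the initial state. -/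
theorem firstFactor_of_step [Coded₂ c] [Coded Z] (hc : IsProd (fun x => 𝒜.letter (w x)) c)
    (hZ₁ : Z 1 = .three β γ (𝒜.letter (w 0)))
    (hZ : ∀ x, 𝒜.ComplStep (Z (x + 1)) (w (x + 1)) (Z (x + 1 + 1))) (hβγ : β * γ = β)
    (x : M.Num) :
    Z (x + 1) = .three β γ (c 0 (x + 1)) ∨ (Z (x + 1) = .one γ ∧ c 0 (x + 1) = β) ∨
      ∃ ζ, Z (x + 1) = .two γ ζ ∧ c 0 (x + 1) = β * ζ := by
  have : Coded fun x => (Z (x + 1), c 0 (x + 1)) := coded_of_finBdd inferInstance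
  refine coded_induction (fun x => (Z (x + 1), c 0 (x + 1)))
    (fun p => p.1 = .three β γ p.2 ∨ (p.1 = .one γ ∧ p.2 = β) ∨
      ∃ ζ, p.1 = .two γ ζ ∧ p.2 = β * ζ) ?_ (fun x hx => ?_) x
  · left
    change Z (0 + 1) = .three β γ (c 0 (0 + 1))
    rw [hc.self_succ, zero_add, hZ₁]
  · have hs := hZ x
    have hc' : c 0 (x + 1 + 1) = c 0 (x + 1) * 𝒜.letter (w (x + 1)) :=
      hc.succ _ _ (Num.zero_le' _)
    simp only at hx ⊢
    rcases hx with hx | ⟨hx, hβ⟩ | ⟨ζ, hx, hζ⟩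
    · rw [hx] at hs
      generalize Z (x + 1 + 1) = s at hs ⊢
      cases hs with
      | threeStep _ _ _ _ ζ' h =>
        left
        rw [hc']
        congr 1
        exact Subtype.ext h
      | threeDone _ _ _ _ h =>
        exact .inr (.inl ⟨rfl, hc'.trans (Subtype.ext h)⟩)
    · rw [hx] at hs
      rw [hβ] at hc'
      generalize Z (x + 1 + 1) = s at hs ⊢
      cases hs with
      | oneStep _ _ ζ' h =>
        refine .inr (.inr ⟨ζ', rfl, ?_⟩)
        rw [hc', show ζ' = 𝒜.letter _ from Subtype.ext h]
      | oneDone _ _ h =>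
        refine .inr (.inl ⟨rfl, ?_⟩)
        rw [hc', show 𝒜.letter _ = γ from Subtype.ext h, hβγ]
    · rw [hx] at hs
      rw [hζ, mul_assoc] at hc'
      generalize Z (x + 1 + 1) = s at hs ⊢
      cases hs with
      | twoStep _ _ _ ζ' h =>
        refine .inr (.inr ⟨ζ', rfl, ?_⟩)
        rw [hc', show ζ' = ζ * 𝒜.letter _ from Subtype.ext h]
      | twoDone _ _ _ h =>
        refine .inr (.inl ⟨rfl, ?_⟩)
        rw [hc', show ζ * 𝒜.letter _ = γ from Subtype.ext h, hβγ]

/-- Invariant for the product read since `m`: the stored ζ if no factor was completed in between, γζ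
otherwise. Idempotence of γ makes the number of completed factors irrelevant. -/
theorem factor_of_step [Coded₂ c] [Coded Z] (hc : IsProd (fun x => 𝒜.letter (w x)) c)
    (hZ : ∀ x, 𝒜.ComplStep (Z (x + 1)) (w (x + 1)) (Z (x + 1 + 1))) (hγγ : γ * γ = γ)
    {m : M.Num} (hm₀ : 0 < m) (hm : Z m = .one γ) {n : M.Num} (hmn : m < n)
    (hn : Z n = .one γ) : c m n = γ := by
  obtain ⟨m, rfl⟩ := Num.exists_eq_add_one hm₀.ne'
  obtain ⟨d, rfl⟩ := Num.exists_eq_add_of_lt hmn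
  have : Coded fun d => (Z (m + 1 + d + 1), c (m + 1) (m + 1 + d + 1)) :=
    coded_of_finBdd inferInstance
  have key : ∀ d, (Z (m + 1 + d + 1) = .one γ ∧ c (m + 1) (m + 1 + d + 1) = γ) ∨
      ∃ ζ, Z (m + 1 + d + 1) = .two γ ζ ∧
        (c (m + 1) (m + 1 + d + 1) = ζ ∨ c (m + 1) (m + 1 + d + 1) = γ * ζ) := by
    intro d
    refine coded_induction (fun d => (Z (m + 1 + d + 1), c (m + 1) (m + 1 + d + 1)))
      (fun p => (p.1 = .one γ ∧ p.2 = γ) ∨ ∃ ζ, p.1 = .two γ ζ ∧ (p.2 = ζ ∨ p.2 = γ * ζ))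
      ?_ (fun d hd => ?_) d
    · have hs := hZ m
      rw [hm] at hs
      simp only [add_zero, hc.self_succ]
      generalize Z (m + 1 + 1) = s at hs ⊢
      cases hs with
      | oneStep _ _ ζ' h => exact .inr ⟨_, rfl, .inl (Subtype.ext h.symm)⟩
      | oneDone _ _ h => exact .inl ⟨rfl, Subtype.ext h⟩
    · have hs := hZ (m + 1 + d)
      have hc' : c (m + 1) (m + 1 + d + 1 + 1) =
          c (m + 1) (m + 1 + d + 1) * 𝒜.letter (w (m + 1 + d + 1)) :=
        hc.succ _ _ (by rw [add_assoc]; exact le_self_add)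
      simp only [← add_assoc] at hd ⊢
      rcases hd with ⟨hd, hγ⟩ | ⟨ζ, hd, hζ⟩
      · rw [hd] at hs
        rw [hγ] at hc'
        rw [hc']
        generalize Z (m + 1 + d + 1 + 1) = s at hs ⊢
        cases hs with
        | oneStep _ _ ζ' h =>
          refine .inr ⟨_, rfl, .inr ?_⟩
          rw [show ζ' = 𝒜.letter _ from Subtype.ext h]
        | oneDone _ _ h =>
          refine .inl ⟨rfl, ?_⟩
          rw [show 𝒜.letter _ = γ from Subtype.ext h, hγγ]
      · rw [hd] at hs
        rw [hc']
        generalize Z (m + 1 + d + 1 + 1) = s at hs ⊢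
        cases hs with
        | twoStep _ _ _ ζ' h =>
          refine .inr ⟨_, rfl, ?_⟩
          rw [show ζ' = ζ * 𝒜.letter _ from Subtype.ext h]
          rcases hζ with hζ | hζ
          · exact .inl (by rw [hζ])
          · exact .inr (by rw [hζ, mul_assoc])
        | twoDone _ _ _ h =>
          refine .inl ⟨rfl, ?_⟩
          have h' : ζ * 𝒜.letter _ = γ := Subtype.ext h
          rcases hζ with hζ | hζ
          · rw [hζ, h']
          · rw [hζ, mul_assoc, h', hγγ]
  rcases key d with ⟨-, h⟩ | ⟨ζ, h, -⟩
  · exact h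
  · rw [hn] at h
    simp at h

theorem firstFactor_of_one [Coded₂ c] [Coded Z] (hc : IsProd (fun x => 𝒜.letter (w x)) c)
    (hZ₁ : Z 1 = .three β γ (𝒜.letter (w 0)))
    (hZ : ∀ x, 𝒜.ComplStep (Z (x + 1)) (w (x + 1)) (Z (x + 1 + 1))) (hβγ : β * γ = β)
    {m : M.Num} (hm₀ : 0 < m) {γ' : 𝒜.Mat} (hm : Z m = .one γ') : γ' = γ ∧ c 0 m = β := by
  obtain ⟨m, rfl⟩ := Num.exists_eq_add_one hm₀.ne'
  rcases firstFactor_of_step hc hZ₁ hZ hβγ m with h | ⟨h, h'⟩ | ⟨ζ, h, -⟩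
  · rw [hm] at h
    simp at h
  · rw [hm] at h
    exact ⟨by simpa using h, h'⟩
  · rw [hm] at h
    simp at h

end Factorisation

/-! ### The two languages are disjoint -/

section Disjoint

variable {r : M.Num → Q}

theorem pos_of_step [Coded₂ c] [Coded r] (hc : IsProd (fun x => 𝒜.letter (w x)) c)
    (hr : ∀ x, ((r x, w x), r (x + 1)) ∈ 𝒜.δ) {x y : M.Num} (hxy : x ≤ y) :
    0 < (c x y).1 (r x) (r y) := by
  obtain ⟨d, rfl⟩ := hxy
  have : Coded fun d => (c x (x + d), r (x + d)) := coded_of_finBdd inferInstance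
  refine coded_induction (fun d => (c x (x + d), r (x + d)))
    (fun p => 0 < p.1.1 (r x) p.2) ?_ (fun d hd => ?_) d
  · simp only [add_zero, hc.self]
    exact Mat.one_pos.2 rfl
  · simp only [← add_assoc] at hd ⊢
    rw [hc.succ _ _ le_self_add, Mat.mul_pos]
    exact ⟨_, hd, letter_pos.2 (hr _)⟩

/-- The letter read just before `y` already has entry ∞, and the other factors contribute positive
entries. Strictness of `x < y` matters because a starting point does not count. -/
theorem eq_top_of_step [Coded₂ c] [Coded r] (hc : IsProd (fun x => 𝒜.letter (w x)) c)
    (hr : ∀ x, ((r x, w x), r (x + 1)) ∈ 𝒜.δ) {x y z : M.Num} (hxy : x < y) (hyz : y ≤ z)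
    (hy : r y ∈ 𝒜.F) : (c x z).1 (r x) (r z) = ⊤ := by
  rw [← hc.mul hxy.le hyz, Mat.mul_eq_top]
  refine ⟨r y, .inl ⟨?_, pos_of_step hc hr hyz⟩⟩
  obtain ⟨d, rfl⟩ := Num.exists_eq_add_of_lt hxy
  rw [hc.succ _ _ le_self_add, Mat.mul_eq_top]
  exact ⟨r (x + d), .inr ⟨pos_of_step hc hr le_self_add, letter_eq_top.2 ⟨hr _, hy⟩⟩⟩

theorem not_isAccRun_of_isAccRun_compl [Finite A] [Coded w] {Z : M.Num → 𝒜.ComplState} [Coded Z]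
    (hZ : 𝒜.compl.IsAccRun w Z) [Coded r] : ¬ 𝒜.IsAccRun w r := by
  intro hr
  have : Coded fun x => 𝒜.letter (w x) := coded_of_finBdd (.map 𝒜.letter fun v => w (v 0))
  obtain ⟨c, hc', hc⟩ := exists_isProd fun x => 𝒜.letter (w x)
  have hZs : ∀ x, 𝒜.ComplStep (Z x) (w x) (Z (x + 1)) := hZ.step
  obtain ⟨β, γ, hrej, hZ₁⟩ : ∃ β γ : 𝒜.Mat, 𝒜.Rejecting β.1 γ.1 ∧
      Z 1 = .three β γ (𝒜.letter (w 0)) := by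
    have h := hZs 0
    rw [show Z 0 = .init from hZ.zero, zero_add] at h
    generalize Z 1 = s at h ⊢
    cases h with
    | start _ β γ ζ h h' => exact ⟨β, γ, h, by rw [show ζ = 𝒜.letter _ from Subtype.ext h']⟩
  obtain ⟨hβγ, hγγ, hrej⟩ := rejecting_iff.1 hrej
  -- One state of the run recurs at unboundedly many cuts, so that the diagonal entry of γ at `q`
  -- comes into play.
  obtain ⟨q, hq⟩ := exists_of_forall_exists_gt
      (fun q y => (0 < y ∧ Z y = .one γ) ∧ r y = q) fun n => by
    obtain ⟨y, hy, γ', h⟩ := hZ.frequently n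
    have hy₀ := (Num.zero_le' n).trans_lt hy
    have := firstFactor_of_one hc hZ₁ (fun x => hZs _) hβγ hy₀ h.symm
    exact ⟨y, hy, _, ⟨hy₀, by rw [← h, this.1]⟩, rfl⟩
  obtain ⟨x, -, ⟨hx₀, hx⟩, hxq⟩ := hq 0
  obtain ⟨y, hxy, hy⟩ := hr.frequently x
  obtain ⟨z, hyz, ⟨hz₀, hz⟩, hzq⟩ := hq y
  have h₁ := pos_of_step hc hr.step hx₀.le
  have h₂ := eq_top_of_step hc hr.step hxy hyz.le hy
  rw [(firstFactor_of_one hc hZ₁ (fun x => hZs _) hβγ hx₀ hx).2, hr.zero, hxq] at h₁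
  rw [factor_of_step hc (fun x => hZs _) hγγ hx₀ hx (hxy.trans hyz) hz, hxq, hzq] at h₂
  exact (hrej q h₁).ne h₂

end Disjoint

end Runs

end NBA

namespace NBA

open SOArith

variable {A Q : Type*} {𝒜 : NBA A Q}

/-! ### Steps towards a given state -/

/-- Reading the letter `a`, the automaton can go from `p` to `p'` such that the matrix `ρ` allows
it to reach `q` afterwards. The accepting states are hit on the way if this is not yet recorded
by `b`. -/
def IsGuidedStep (𝒜 : NBA A Q) (q : Q) (a : A) (ρ : 𝒜.Mat) (p : Q) (b : Bool) (p' : Q) : Prop :=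
  ((p, a), p') ∈ 𝒜.δ ∧ (ρ.1 p' q = ⊤ ∨ ((b = true ∨ p' ∈ 𝒜.F) ∧ 0 < ρ.1 p' q))

open Classical in
/-- A step to a state that is allowed by `IsGuidedStep`; the record is cleared if `m` holds. -/
noncomputable def guidedStep (𝒜 : NBA A Q) (q : Q) (a : A) (ρ : 𝒜.Mat) (m : Prop)
    (s : Q × Bool) : Q × Bool :=
  let p' := if h : ∃ p', 𝒜.IsGuidedStep q a ρ s.1 s.2 p' then h.choose else s.1
  (p', if m then false else decide (s.2 = true ∨ p' ∈ 𝒜.F))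

theorem guidedStep_snd_of_pos {q : Q} {a : A} {ρ : 𝒜.Mat} {m : Prop} (s : Q × Bool) (hm : m) :
    (𝒜.guidedStep q a ρ m s).2 = false := if_pos hm

theorem guidedStep_snd_of_neg {q : Q} {a : A} {ρ : 𝒜.Mat} {m : Prop} (s : Q × Bool) (hm : ¬ m) :
    (𝒜.guidedStep q a ρ m s).2 = true ↔ s.2 = true ∨ (𝒜.guidedStep q a ρ m s).1 ∈ 𝒜.F := by
  classical
  have : (𝒜.guidedStep q a ρ m s).2 =
    decide (s.2 = true ∨ (𝒜.guidedStep q a ρ m s).1 ∈ 𝒜.F) := (if_neg hm).trans (by congr)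
  rw [this, decide_eq_true_iff]

variable [Finite Q] {M : Str.{u}} [hM : IsModel M]
  {w : M.Num → A} {c : M.Num → M.Num → 𝒜.Mat}

/-! ### A run of the complement automaton along a homogeneous set -/

section Greedy

variable {Z : M.Num → 𝒜.ComplState} {β γ : 𝒜.Mat} {H : M.Num → Prop}

/-- A run that never closes its first factor stores c(0, x) for ever, but at an element of `H` that
product is β and the factor is closed. -/
theorem greedy_exists_one [Coded₂ c] [Coded Z] (hc : IsProd (fun x => 𝒜.letter (w x)) c)
    (hZ₀ : Z 0 = .init) (hZ : ∀ x, Z (x + 1) = greedyStep β γ (w x) (H (x + 1)) (Z x))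
    (hβ : ∀ y, H y → 0 < y ∧ c 0 y = β) (hH : ∀ n, ∃ y, n < y ∧ H y) :
    ∃ m, 0 < m ∧ Z m = .one γ := by
  by_contra! hne
  have : Coded fun x => (Z (x + 1), c 0 (x + 1)) := coded_of_finBdd inferInstance
  have key : ∀ x, Z (x + 1) = .three β γ (c 0 (x + 1)) := by
    intro x
    refine coded_induction (fun x => (Z (x + 1), c 0 (x + 1))) (fun p => p.1 = .three β γ p.2)
      ?_ (fun x hx => ?_) x
    · simp only
      rw [hZ, hZ₀, hc.self_succ]
      rfl
    · have h := hZ (x + 1)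
      have hne := hne (x + 1 + 1) (Num.zero_le' _ |>.trans_lt (Num.lt_add_one _))
      simp only at hx ⊢
      rw [hx, greedyStep] at h
      rw [hc.succ _ _ (Num.zero_le' _)]
      split_ifs at h with h'
      · exact absurd h hne
      · exact h
  -- An element above 1 is needed: the step into it must start after the initial state has been
  -- left.
  obtain ⟨y, hy, hHy⟩ := hH 1
  obtain ⟨d, rfl⟩ := Num.exists_eq_add_of_lt hy
  have h := hZ (1 + d)
  rw [add_comm 1 d, key d, greedyStep, if_pos] at h
  · exact hne _ (Num.zero_le' _ |>.trans_lt (Num.lt_add_one _)) h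
  · rw [add_comm 1 d] at hHy
    exact ⟨hHy, (hc.succ 0 (d + 1) (Num.zero_le' _)).symm.trans (hβ _ hHy).2⟩

/-- The guard forces the cut `m` to lie in `H`, so c(m, y) = γ for all large y in `H`. An open
factor stores exactly c(m, x), and is therefore closed at such a y at the latest. -/
theorem greedy_exists_next [Coded₂ c] [Coded Z] (hc : IsProd (fun x => 𝒜.letter (w x)) c)
    (hZ : ∀ x, Z (x + 1) = greedyStep β γ (w x) (H (x + 1)) (Z x))
    (hγ : ∀ x, H x → ∃ n, ∀ y, n < y → H y → c x y = γ) (hH : ∀ n, ∃ y, n < y ∧ H y)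
    {m : M.Num} (hm₀ : 0 < m) (hm : Z m = .one γ) : ∃ n, m < n ∧ Z n = .one γ := by
  by_contra! hne
  have : Coded fun x => (Z (m + x + 1), c m (m + x + 1)) := coded_of_finBdd inferInstance
  have key : ∀ x, Z (m + x + 1) = .two γ (c m (m + x + 1)) := by
    intro x
    refine coded_induction (fun x => (Z (m + x + 1), c m (m + x + 1)))
      (fun p => p.1 = .two γ p.2) ?_ (fun x hx => ?_) x
    · have h := hZ m
      have hne := hne (m + 1) (Num.lt_add_one _)
      simp only [add_zero, hc.self_succ]
      rw [hm, greedyStep] at h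
      split_ifs at h with h'
      · exact absurd h hne
      · exact h
    · have h := hZ (m + x + 1)
      have hne := hne (m + x + 1 + 1) ((Num.lt_add_add_one m x).trans (Num.lt_add_one _))
      simp only [← add_assoc] at hx ⊢
      rw [hx, greedyStep] at h
      rw [hc.succ _ _ (Num.lt_add_add_one m x).le]
      split_ifs at h with h'
      · exact absurd h hne
      · exact h
  have hHm : H m := by
    obtain ⟨m, rfl⟩ := Num.exists_eq_add_one hm₀.ne'
    exact of_greedyStep_eq_one ((hZ m).symm.trans hm)
  obtain ⟨n, hn⟩ := hγ m hHm
  obtain ⟨y, hy, hHy⟩ := hH (max n (m + 1))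
  rw [max_lt_iff] at hy
  obtain ⟨d, rfl⟩ := Num.exists_eq_add_of_lt hy.2
  have h := hZ (m + 1 + d)
  have e : m + 1 + d = m + d + 1 := add_right_comm _ _ _
  rw [e] at h hHy hy
  rw [key d, greedyStep, if_pos] at h
  · exact hne _ ((Num.lt_add_add_one m d).trans (Num.lt_add_one _)) h
  · exact ⟨hHy, by rw [← hn _ hy.1 hHy, hc.succ _ _ (Num.lt_add_add_one m d).le]⟩

theorem greedy_frequently [Coded₂ c] [Coded Z] (hc : IsProd (fun x => 𝒜.letter (w x)) c)
    (hZ₀ : Z 0 = .init) (hZ : ∀ x, Z (x + 1) = greedyStep β γ (w x) (H (x + 1)) (Z x))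
    (hβ : ∀ y, H y → 0 < y ∧ c 0 y = β) (hγ : ∀ x, H x → ∃ n, ∀ y, n < y → H y → c x y = γ)
    (hH : ∀ n, ∃ y, n < y ∧ H y) (n : M.Num) : ∃ m, n < m ∧ Z m = .one γ := by
  refine Num.induction (fun n => ∃ m, n < m ∧ Z m = .one γ)
    (greedy_exists_one hc hZ₀ hZ hβ hH) (fun n ih => ?_) n
  obtain ⟨m, hnm, hm⟩ := ih
  obtain ⟨k, hmk, hk⟩ := greedy_exists_next hc hZ hγ hH ((Num.zero_le' n).trans_lt hnm) hm
  obtain ⟨d, rfl⟩ := Num.exists_eq_add_of_lt hnm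
  refine ⟨k, lt_of_le_of_lt ?_ hmk, hk⟩
  rw [add_right_comm]
  exact le_self_add

end Greedy

/-! ### A run of the automaton along a factorisation that is not rejecting -/

section Guided

theorem exists_isGuidedStep {q : Q} {a : A} {ρ : 𝒜.Mat} {p : Q} {b : Bool}
    (h : (𝒜.letter a * ρ).1 p q = ⊤ ∨ (b = true ∧ 0 < (𝒜.letter a * ρ).1 p q)) :
    ∃ p', 𝒜.IsGuidedStep q a ρ p b p' := by
  unfold IsGuidedStep
  simp only [Mat.mul_eq_top, Mat.mul_pos, letter_eq_top, letter_pos] at h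
  rcases h with ⟨p', ⟨⟨h, hF⟩, h'⟩ | ⟨h, h'⟩⟩ | ⟨hb, p', h, h'⟩
  · exact ⟨p', h, .inr ⟨.inr hF, h'⟩⟩
  · exact ⟨p', h, .inl h'⟩
  · exact ⟨p', h, .inr ⟨.inl hb, h'⟩⟩

/-- Under this hypothesis a suitable successor exists, so the default value of `guidedStep`, staying
in the same state, is not used. -/
theorem guidedStep_spec {q : Q} {a : A} {ρ : 𝒜.Mat} (m : Prop) {s : Q × Bool}
    (h : (𝒜.letter a * ρ).1 s.1 q = ⊤ ∨ (s.2 = true ∧ 0 < (𝒜.letter a * ρ).1 s.1 q)) :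
    𝒜.IsGuidedStep q a ρ s.1 s.2 (𝒜.guidedStep q a ρ m s).1 := by
  have h' := exists_isGuidedStep h
  unfold guidedStep
  simp only [dif_pos h']
  exact h'.choose_spec

variable {P : M.Num → Prop} {β γ : 𝒜.Mat} {q : Q}

/-- ρ(x) is the product from x to the least element of `P` at or after x, hence 1 on `P` itself. It
tells a run how its position relates to the next cut; in the last clause z is the next cut strictly
after x. -/
theorem exists_coded_next [Coded₂ c] [Coded P] (hc : IsProd (fun x => 𝒜.letter (w x)) c)
    (hP : ∀ n, ∃ m, n < m ∧ P m) :
    ∃ ρ : M.Num → 𝒜.Mat, Coded ρ ∧ (∀ x, P x → ρ x = 1) ∧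
      ∀ x, ∃ z, x < z ∧ P z ∧ c x z = 𝒜.letter (w x) * ρ (x + 1) ∧ (¬ P x → ρ x = c x z) := by
  have hPb {n : ℕ} (f : (Fin n → M.Num) → M.Num) [IsTm f] : Bdd fun v => P (f v) :=
    .pred (fun p : Prop => p) fun v => P (f v)
  have hnext : ∀ x, ∃ z, (x ≤ z ∧ P z) ∧ ∀ y, y < z → ¬ (x ≤ y ∧ P y) := fun x => by
    obtain ⟨m, hm, hm'⟩ := hP x
    exact Num.exists_least (fun z => x ≤ z ∧ P z) ⟨m, hm.le, hm'⟩
  choose f hf hf' using hnext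
  have huniq : ∀ x z, (x ≤ z ∧ P z) → (∀ y, y < z → ¬ (x ≤ y ∧ P y)) → z = f x := by
    intro x z hz hz'
    rcases lt_trichotomy z (f x) with h | h | h
    · exact absurd hz (hf' x z h)
    · exact h
    · exact absurd (hf x) (hz' _ h)
  have hρ : ∀ x s, c x (f x) = s ↔
      ∃ z, ((x ≤ z ∧ P z) ∧ ∀ y, y < z → ¬ (x ≤ y ∧ P y)) ∧ c x z = s := by
    intro x s
    constructor
    · exact fun h => ⟨f x, ⟨hf x, hf' x⟩, h⟩
    · rintro ⟨z, ⟨h, h'⟩, rfl⟩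
      rw [huniq x z h h']
  have hself : ∀ x, P x → f x = x := fun x hx =>
    (huniq x x ⟨le_rfl, hx⟩ fun y hy h => hy.not_ge h.1).symm
  refine ⟨fun x => c x (f x), coded_of_sig fun s => ?_, fun x hx => ?_, fun x => ?_⟩
  · simp only [hρ]
    infer_instance
  · simp only [hself x hx, hc.self]
  · have hlt : x < f (x + 1) := (Num.lt_add_one x).trans_le (hf (x + 1)).1
    refine ⟨f (x + 1), hlt, (hf (x + 1)).2, ?_, fun hx => ?_⟩
    · rw [← hc.mul (Num.lt_add_one x).le (hf (x + 1)).1, hc.self_succ]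
    · rw [huniq x (f (x + 1)) ⟨hlt.le, (hf (x + 1)).2⟩]
      rintro y hy ⟨hxy, hPy⟩
      rcases hxy.lt_or_eq with h | rfl
      · obtain ⟨d, rfl⟩ := Num.exists_eq_add_of_lt h
        refine hf' (x + 1) _ hy ⟨?_, hPy⟩
        rw [add_right_comm]
        exact le_self_add
      · exact hx hPy

theorem exists_isAccRun_of_factorisation [Finite A] [Coded w] [Coded₂ c] [Coded P]
    (hc : IsProd (fun x => 𝒜.letter (w x)) c) (hP : ∀ n, ∃ m, n < m ∧ P m)
    (hβ : ∀ m, P m → c 0 m = β) (hγ : ∀ m n, P m → m < n → P n → c m n = γ)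
    (hq : 0 < β.1 𝒜.q₀ q) (hq' : γ.1 q q = ⊤) :
    ∃ r : M.Num → Q, Coded r ∧ 𝒜.IsAccRun w r := by
  obtain ⟨ρ, hρ, hρ₁, hρ₂⟩ := exists_coded_next hc hP
  have hG : Coded fun x => 𝒜.guidedStep q (w x) (ρ (x + 1)) (P (x + 1)) :=
    coded_of_finBdd (.map (fun t : A × 𝒜.Mat × Prop => 𝒜.guidedStep q t.1 t.2.1 t.2.2)
      fun v => (w (v 0), ρ (v 0 + 1), P (v 0 + 1)))
  -- The record starts as `true`: β(q₀, q) is only known to be positive, so no accepting state is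
  -- owed in the first factor.
  obtain ⟨Y, hY, hY₀, hY₁⟩ := exists_rec
    (fun x => 𝒜.guidedStep q (w x) (ρ (x + 1)) (P (x + 1))) (𝒜.q₀, true)
  have hnext : ∀ x, P x → 𝒜.letter (w x) * ρ (x + 1) = γ := fun x hx => by
    obtain ⟨z, hxz, hz, h, -⟩ := hρ₂ x
    rw [← h, hγ x z hx hxz hz]
  have hnext' : ∀ x, ¬ P x → 𝒜.letter (w x) * ρ (x + 1) = ρ x := fun x hx => by
    obtain ⟨z, -, -, h, h'⟩ := hρ₂ x
    rw [← h, h' hx]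
  have hcode : Coded fun x => (Y x, 𝒜.letter (w x) * ρ (x + 1)) := by
    have := FinBdd.map₂ (M := M) (n := 1) (fun a (ρ : 𝒜.Mat) => 𝒜.letter a * ρ)
      (fun v => w (v 0)) (fun v => ρ (v 0 + 1))
    exact coded_of_finBdd inferInstance
  -- Invariant: from the current state `q` can be reached at the next cut strictly after x, hitting
  -- an accepting state unless one is already recorded. At a cut ρ = 1 forces the state to be `q`,
  -- and γ(q, q) = ∞ starts the next factor.
  have key : ∀ x, (𝒜.letter (w x) * ρ (x + 1)).1 (Y x).1 q = ⊤ ∨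
      ((Y x).2 = true ∧ 0 < (𝒜.letter (w x) * ρ (x + 1)).1 (Y x).1 q) := by
    intro x
    refine coded_induction (fun x => (Y x, 𝒜.letter (w x) * ρ (x + 1)))
      (fun p => p.2.1 p.1.1 q = ⊤ ∨ (p.1.2 = true ∧ 0 < p.2.1 p.1.1 q)) ?_ (fun x hx => ?_) x
    · obtain ⟨z, -, hz, h, -⟩ := hρ₂ 0
      simp only
      rw [← h, hY₀, hβ z hz]
      exact .inr ⟨rfl, hq⟩
    · have hs := guidedStep_spec (P (x + 1)) hx
      rw [← hY₁] at hs
      simp only at hs ⊢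
      by_cases hPx : P (x + 1)
      · rw [hnext _ hPx]
        rw [hρ₁ _ hPx] at hs
        rcases hs.2 with h | ⟨-, h⟩
        · exact absurd h Mat.one_ne_top
        · rw [Mat.one_pos.1 h]
          exact .inl hq'
      · rw [hnext' _ hPx]
        rcases hs.2 with h | ⟨h, h'⟩
        · exact .inl h
        · refine .inr ⟨?_, h'⟩
          rw [hY₁, guidedStep_snd_of_neg _ hPx, ← hY₁]
          exact h
  have hstep : ∀ x, 𝒜.IsGuidedStep q (w x) (ρ (x + 1)) (Y x).1 (Y x).2 (Y (x + 1)).1 := by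
    intro x
    rw [hY₁]
    exact guidedStep_spec _ (key x)
  refine ⟨fun x => (Y x).1, coded_of_finBdd (.map Prod.fst fun v => Y (v 0)), ?_, fun x => ?_,
    fun x => ?_⟩
  · rw [hY₀]
  · exact (hstep x).1
  -- Without accepting states beyond x, the record cleared at the first available cut stays `false`.
  -- The step into a later cut has ρ = 1, whose entries are never ∞, so it demands a record or an
  -- accepting state.
  · by_contra! hF
    obtain ⟨m, hxm, hm⟩ := hP x
    obtain ⟨k, rfl⟩ := Num.exists_eq_add_of_lt hxm
    have hfalse : ∀ d, (Y (x + k + 1 + d)).2 = false := by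
      intro d
      have : Coded fun d => Y (x + k + 1 + d) := coded_of_finBdd inferInstance
      refine coded_induction (fun d => Y (x + k + 1 + d)) (fun s => s.2 = false) ?_
        (fun d hd => ?_) d
      · rw [add_zero, hY₁]
        exact guidedStep_snd_of_pos _ hm
      · have hF' := hF (x + k + 1 + d + 1) ((hxm.trans_le le_self_add).trans (Num.lt_add_one _))
        by_cases hPd : P (x + k + 1 + d + 1)
        · rw [← add_assoc, hY₁]
          exact guidedStep_snd_of_pos _ hPd
        · rw [← Bool.not_eq_true, ← add_assoc, hY₁, guidedStep_snd_of_neg _ hPd, ← hY₁, hd]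
          simpa using hF'
    obtain ⟨n, hmn, hn⟩ := hP (x + k + 1)
    obtain ⟨d, rfl⟩ := Num.exists_eq_add_of_lt hmn
    have hs := (hstep (x + k + 1 + d)).2
    rw [hρ₁ _ hn, hfalse] at hs
    rcases hs with h | ⟨h | h, -⟩
    · exact Mat.one_ne_top h
    · exact Bool.false_ne_true h
    · exact hF _ (hxm.trans hmn) h

end Guided

/-- The greedy sequence is built before it is known whether (β, γ) is rejecting, since only the
transition out of the initial state depends on that. If it is not, the accepting positions still
give a factorisation whose products are exactly β and γ, which `H` alone would not provide. -/
theorem exists_isAccRun_compl [Finite A] [Coded w]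
    (hw : ¬ ∃ r : M.Num → Q, Coded r ∧ 𝒜.IsAccRun w r) :
    ∃ Z : M.Num → 𝒜.ComplState, Coded Z ∧ 𝒜.compl.IsAccRun w Z := by
  have : Coded fun x => 𝒜.letter (w x) := coded_of_finBdd (.map 𝒜.letter fun v => w (v 0))
  obtain ⟨c, hc', hc⟩ := exists_isProd fun x => 𝒜.letter (w x)
  obtain ⟨H, β, γ, hHc, hβγ, hγγ, hβ, hH, hγ⟩ := hc.exists_ramsey
  have hG : Coded fun x => greedyStep β γ (w x) (H (x + 1)) :=
    coded_of_finBdd (.map (fun t : A × Prop => greedyStep β γ t.1 t.2)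
      fun v => (w (v 0), H (v 0 + 1)))
  obtain ⟨Z, hZc, hZ₀, hZ⟩ := exists_rec (fun x => greedyStep β γ (w x) (H (x + 1))) .init
  have hfreq := greedy_frequently hc hZ₀ hZ hβ hγ hH
  have hstep : ∀ x, 𝒜.ComplStep (Z (x + 1)) (w (x + 1)) (Z (x + 1 + 1)) := fun x => by
    rw [hZ (x + 1)]
    refine complStep_greedyStep _ _ _ _ ?_
    rw [hZ]
    exact greedyStep_ne_init _ _ _ _ _
  have hZ₁ : Z 1 = .three β γ (𝒜.letter (w 0)) := by
    have := hZ 0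
    rwa [hZ₀, zero_add] at this
  by_cases hrej : 𝒜.Rejecting β.1 γ.1
  · refine ⟨Z, hZc, hZ₀, fun x => ?_, fun n => ?_⟩
    · change 𝒜.ComplStep (Z x) (w x) (Z (x + 1))
      rcases eq_or_ne x 0 with rfl | hx
      · rw [hZ₀, zero_add, hZ₁]
        exact .start _ _ _ _ hrej rfl
      · obtain ⟨y, rfl⟩ := Num.exists_eq_add_one hx
        exact hstep y
    · obtain ⟨m, hm, h⟩ := hfreq n
      exact ⟨m, hm, γ, h.symm⟩
  · refine absurd ?_ hw
    rw [rejecting_iff] at hrej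
    push Not at hrej
    obtain ⟨q, hq, hq'⟩ := hrej hβγ hγγ
    have hP : Coded fun m => Z m = .one γ :=
      coded_of_finBdd (.map (fun s => s = .one γ) fun v => Z (v 0))
    have hpos : ∀ m, Z m = .one γ → 0 < m := by
      intro m hm
      refine (Num.zero_le' m).lt_of_ne ?_
      rintro rfl
      rw [hZ₀] at hm
      simp at hm
    exact exists_isAccRun_of_factorisation hc hfreq
      (fun m hm => (firstFactor_of_one hc hZ₁ hstep hβγ (hpos m hm) hm).2)
      (fun m n hm hmn hn => factor_of_step hc hstep hγγ (hpos m hm) hm hmn hn) hq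
      (top_le_iff.1 hq')

end NBA

theorem mainTheorem10 {A Q : Type*} [Finite A] [Finite Q] (𝒜 : NBA A Q)
    (cA : A ↪ ℕ) (cQ : Q ↪ ℕ) (cQc : 𝒜.ComplState ↪ ℕ) :
    SOArith.Proves.{u} SOArith.RCA0 (𝒜.complCorrect cA cQ cQc) := by
  intro M hM
  have : SOArith.IsModel M := ⟨hM⟩
  intro X
  refine imp_iff_not_or.1 fun h => ?_
  obtain ⟨w, hw⟩ := (SOArith.Fm.realize_isSeq _ _ _ _).1 h
  have := SOArith.Represents.coded cA.injective hw
  simp only [SOArith.Fm.iff, SOArith.Fm.imp, SOArith.Fm.Realize, ← imp_iff_not_or, ← iff_def,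
    NBA.realize_inLang _ cA.injective cQ.injective _ _ _ hw,
    NBA.realize_inLang _ cA.injective cQc.injective _ _ _ hw]
  constructor
  · rintro ⟨Z, _, hZ⟩ ⟨r, _, hr⟩
    exact NBA.not_isAccRun_of_isAccRun_compl hZ hr
  · exact NBA.exists_isAccRun_compl
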